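/- Let $H>0$, $\lambda>0$, $\sigma>0$. Let $B_{H,\lambda}=\{B_{H,\lambda}(t)\}_{t\in\mathbb R}$ be tempered fractional Brownian motion, $$B_{H,\lambda}(t)=\int_{\mathbb R}\{e^{-\lambda(t-u)_+}(t-u)_+^{H-1/2}-e^{-\lambda(-u)_+}(-u)_+^{H-1/2}\}\,B(du),$$ where $B(du)$ is an independently scattered Gaussian random measure with $\mathbb E\,B(du)^2=\sigma^2du$ and $e^{-\lambda x_+}(x)_+^{H-1/2}$ is read as $0$ for $x\le 0$. Let $\phi,\psi:\mathbb R\to\mathbb R$ be the scaling function and the wavelet of an orthonormal multiresolution analysis of $L^2(\mathbb R)$: with $f_{j,k}(t)=2^{-j/2}f(2^{-j}t-k)$ and $V_j,W_j$ the closed linear spans of $\{\phi_{j,k}\}_{k\in\mathbb Z}$ and $\{\psi_{j,k}\}_{k\in\mathbb Z}$, both families are orthonormal for each $j\in\mathbb Z$, $V_{j+1}\subseteq V_j$, $\bigcap_jV_j=\{0\}$, $\bigcup_jV_j$ is dense in $L^2(\mathbb R)$, and $W_{j+1}$ is the orthogonal complement of $V_{j+1}$ in $V_j$. Write $\widehat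 f(x)=\int_{\mathbb R}e^{-ixt}f(t)\,dt$ and assume that * $\int\psi^2=1$ and, for some integer $N_\psi\ge1$, $\int t^p\psi(t)\,dt=0$ for $0\le p<N_\psi$ and $\int t^{N_\psi}\psi(t)\,dt\neq0$; * $\phi,\psi\in L^1(\mathbb R)$ are compactly supported, and $\widehat\phi(0)=1$; * $\sup_x|\widehat\psi(x)|(1+|x|)^\alpha<\infty$ for some $\alpha>1$; * for $m=0,\dots,N_\psi-1$ the function $\sum_{k\in\mathbb Z}k^m\phi(\cdot-k)$ is (almost everywhere) a polynomial of degree $m$. Define the wavelet coefficients $d(2^j,k)$, $j\ge1$, $k\in\mathbb Z$, of the discrete-time series $\{B_{H,\lambda}(\ell)\}_{\ell\in\mathbb Z}$ by the pyramidal algorithm $$a(2^0,k)=B_{H,\lambda}(k),\quad a(2^{j+1},k)=\sum_{k'\in\mathbb Z}u_{k'-2k}\,a(2^j,k'),\quad d(2^{j+1},k)=\sum_{k'\in\mathbb Z}v_{k'-2k}\,a(2^j,k')\qquad(j\ge0),$$ $$u_k=2^{-1/2}\int\phi(t/2)\phi(t-k)\,dt,\qquad v_k=2^{-1/2}\int\psi(t/2)\phi(t-k)\,dt,$$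 and let $$h_{j,\ell}=2^{-j/2}\int_{\mathbb R}\phi(t+\ell)\psi(2^{-j}t)\,dt,\qquad \mathcal H_j(x)=\sum_{\ell\in\mathbb Z}h_{j,\ell}e^{ix\ell}.$$ Then each $d(2^j,k)$ is square integrable with mean zero, the series and integrals below converge, and: 1. for all $j,j'\ge1$ and $k,k'\in\mathbb Z$, $$\mathbb E\,d(2^j,k)d(2^{j'},k')=\frac{\sigma^2\Gamma^2(H+\frac12)}{2\pi}\int_{-\pi}^{\pi}e^{-ix(2^jk-2^{j'}k')}\sum_{\ell\in\mathbb Z}\frac{\mathcal H_j(x)\overline{\mathcal H_{j'}(x)}}{|\lambda^2+(x+2\pi\ell)^2|^{H+\frac12}}\,dx;$$ 2. for all $j\ge1$ and every $k\in\mathbb Z$, $$\mathbb E\,d^2(2^j,k)=\frac{\sigma^2\Gamma^2(H+\frac12)}{2\pi}\int_{-\pi}^{\pi}\sum_{\ell\in\mathbb Z}\frac{|\mathcal H_j(x)|^2}{|\lambda^2+(x+2\pi\ell)^2|^{H+\frac12}}\,dx,$$ which does not depend on $k$; 3. for every $k\in\mathbb Z$, $$\lim_{j\to\infty}\mathbb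 E\,d^2(2^j,k)=\sum_{\ell\in\mathbb Z}\frac{\sigma^2\Gamma^2(H+\frac12)}{|\lambda^2+(2\pi\ell)^2|^{H+\frac12}}.$$ -/

import Mathlib

open MeasureTheory ProbabilityTheory Filter Topology

noncomputable section

namespace TFBM

/-! ### Gaussian random measures, Wiener integrals, tempered fractional Brownian motion -/

/-- `M` is an independently scattered Gaussian random measure on `ℝ` with control measure
`σ² du`. It is a function of Borel sets of finite Lebesgue measure; its values on other sets are
irrelevant. The countable additivity is almost sure convergence of the partial sums (such a series
need not converge absolutely). -/
structure IsGaussianRandomMeasure {Ω : Type*} [MeasurableSpace Ω] (P : Measure Ω) (σ : ℝ)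
    (M : Set ℝ → Ω → ℝ) : Prop where
  aemeasurable : ∀ A : Set ℝ, MeasurableSet A → volume A ≠ ⊤ → AEMeasurable (M A) P
  gaussian : ∀ A : Set ℝ, MeasurableSet A → volume A ≠ ⊤ →
    P.map (M A) = gaussianReal 0 (Real.toNNReal (σ ^ 2 * volume.real A))
  independent : ∀ A : ℕ → Set ℝ, (∀ i, MeasurableSet (A i)) → (∀ i, volume (A i) ≠ ⊤) →
    Pairwise (fun i j => Disjoint (A i) (A j)) → iIndepFun (fun i => M (A i)) P
  additive : ∀ A : ℕ → Set ℝ, (∀ i, MeasurableSet (A i)) →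
    Pairwise (fun i j => Disjoint (A i) (A j)) → volume (⋃ i, A i) ≠ ⊤ →
    ∀ᵐ ω ∂P, Tendsto (fun n => ∑ i ∈ Finset.range n, M (A i) ω) atTop (𝓝 (M (⋃ i, A i) ω))

/-- `X` is (a version of) the stochastic integral `∫ f(u) M(du)`: `f ∈ L²(ℝ)`, `X ∈ L²(P)`, and
there are step functions `∑ cᵢ 1_{Aᵢ}` arbitrarily close to `f` in `L²(ℝ)` whose integrals
`∑ cᵢ M(Aᵢ)` are arbitrarily close to `X` in `L²(P)`. -/
def IsStochasticIntegral {Ω : Type*} [MeasurableSpace Ω] (P : Measure Ω) (M : Set ℝ → Ω → ℝ)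
    (f : ℝ → ℝ) (X : Ω → ℝ) : Prop :=
  MemLp f 2 volume ∧ MemLp X 2 P ∧
    ∀ ε : ENNReal, 0 < ε → ∃ (n : ℕ) (c : Fin n → ℝ) (A : Fin n → Set ℝ),
      (∀ i, MeasurableSet (A i)) ∧ (∀ i, volume (A i) ≠ ⊤) ∧
      eLpNorm (fun u => f u - ∑ i, c i * (A i).indicator (fun _ => (1 : ℝ)) u) 2 volume < ε ∧
      eLpNorm (fun ω => X ω - ∑ i, c i * M (A i) ω) 2 P < ε

/-- `e^{-λ x₊} (x₊)^{H-1/2}`, with the convention that it vanishes for `x ≤ 0`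
(also when `H ≤ 1/2`). -/
def temperedPower (H lam x : ℝ) : ℝ :=
  if 0 < x then Real.exp (-lam * x) * x ^ (H - 1 / 2) else 0

/-- The process `B` is the tempered fractional Brownian motion with Hurst parameter `H` and
tempering parameter `lam` driven by the Gaussian random measure `M`, that is
`B(t) = ∫ {e^{-λ(t-u)₊}(t-u)₊^{H-1/2} - e^{-λ(-u)₊}(-u)₊^{H-1/2}} M(du)` for every `t`. -/
def IsTemperedFBM {Ω : Type*} [MeasurableSpace Ω] (P : Measure Ω) (H lam : ℝ)
    (M : Set ℝ → Ω → ℝ) (B : ℝ → Ω → ℝ) : Prop :=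
  ∀ t : ℝ, IsStochasticIntegral P M
    (fun u => temperedPower H lam (t - u) - temperedPower H lam (-u)) (B t)

/-! ### Multiresolution analyses -/

/-- `f_{j,k}(t) = 2^{-j/2} f(2^{-j} t - k)`. -/
def dyadic (f : ℝ → ℝ) (j k : ℤ) (t : ℝ) : ℝ :=
  (2 : ℝ) ^ (-(j : ℝ) / 2) * f ((2 : ℝ) ^ (-j) * t - k)

theorem memLp_dyadic {f : ℝ → ℝ} (hf : MemLp f 2 volume) (j k : ℤ) :
    MemLp (dyadic f j k) 2 volume := by
  have h1 : MemLp (fun t : ℝ => f (t - k)) 2 volume :=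
    hf.comp_measurePreserving (measurePreserving_sub_right volume (k : ℝ))
  have ha : (2 : ℝ) ^ (-j) ≠ 0 := zpow_ne_zero _ two_ne_zero
  have h2 : MemLp (fun t : ℝ => f (t - k)) 2 (volume.map fun t => (2 : ℝ) ^ (-j) * t) := by
    rw [Real.map_volume_mul_left ha]
    exact h1.smul_measure ENNReal.ofReal_ne_top
  have h3 := h2.comp_of_map (measurable_const_mul ((2 : ℝ) ^ (-j))).aemeasurable
  exact h3.const_mul ((2 : ℝ) ^ (-(j : ℝ) / 2))

/-- `f_{j,k}` as an element of `L²(ℝ)`. -/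
def dyadicLp {f : ℝ → ℝ} (hf : MemLp f 2 volume) (j k : ℤ) : Lp ℝ 2 (volume : Measure ℝ) :=
  (memLp_dyadic hf j k).toLp (dyadic f j k)

/-- The closed linear span of `{f_{j,k} : k ∈ ℤ}` in `L²(ℝ)`. For a scaling function this is the
approximation space `V_j`, for a wavelet the detail space `W_j`, at scale `2^j`. -/
def dyadicSpan {f : ℝ → ℝ} (hf : MemLp f 2 volume) (j : ℤ) :
    Submodule ℝ (Lp ℝ 2 (volume : Measure ℝ)) :=
  (Submodule.span ℝ (Set.range (dyadicLp hf j))).topologicalClosure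

/-- `φ` is the scaling function and `ψ` the wavelet of an orthonormal multiresolution analysis of
`L²(ℝ)`. Larger `j` means coarser scale, so `V_{j+1} ⊆ V_j`. The spaces `V_j` are the closed spans
of the `φ_{j,k}`, so that their invariance under translation and dilation is automatic. -/
structure IsMRA (φ ψ : ℝ → ℝ) : Prop where
  memLp_phi : MemLp φ 2 volume
  memLp_psi : MemLp ψ 2 volume
  orthonormal_phi : ∀ j : ℤ, Orthonormal ℝ (dyadicLp memLp_phi j)
  nested : ∀ j : ℤ, dyadicSpan memLp_phi (j + 1) ≤ dyadicSpan memLp_phi j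
  iInf_eq : ⨅ j : ℤ, dyadicSpan memLp_phi j = ⊥
  closure_iSup_eq : (⨆ j : ℤ, dyadicSpan memLp_phi j).topologicalClosure = ⊤
  orthonormal_psi : ∀ j : ℤ, Orthonormal ℝ (dyadicLp memLp_psi j)
  detail : ∀ j : ℤ,
    dyadicSpan memLp_psi (j + 1) = (dyadicSpan memLp_phi (j + 1))ᗮ ⊓ dyadicSpan memLp_phi j

/-- `f̂(x) = ∫ e^{-ixt} f(t) dt`. -/
def fourierHat (f : ℝ → ℝ) (x : ℝ) : ℂ :=
  ∫ t : ℝ, Complex.exp (-(Complex.I * x * t)) * (f t : ℂ)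

/-- The standing assumptions on the scaling function `φ` and the wavelet `ψ`: they come from an
orthonormal multiresolution analysis, `ψ` has exactly `N ≥ 1` vanishing moments, `φ` and `ψ` are
integrable and compactly supported with `φ̂(0) = 1`, the transform of `ψ` decays faster than
`|x|^{-α}` for some `α > 1`, and `∑ₖ kᵐ φ(· - k)` is a polynomial of degree `m` for all `m < N`. -/
structure IsAdmissibleWavelet (φ ψ : ℝ → ℝ) (N : ℕ) : Prop where
  mra : IsMRA φ ψ
  one_le : 1 ≤ N
  integral_sq : ∫ t : ℝ, ψ t ^ 2 = 1
  moment_eq_zero : ∀ p : ℕ, p < N → ∫ t : ℝ, t ^ p * ψ t = 0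
  moment_ne_zero : ∫ t : ℝ, t ^ N * ψ t ≠ 0
  integrable_phi : Integrable φ volume
  integrable_psi : Integrable ψ volume
  compact_phi : HasCompactSupport φ
  compact_psi : HasCompactSupport ψ
  hat_phi_zero : fourierHat φ 0 = 1
  hat_psi_decay : ∃ α : ℝ, 1 < α ∧ ∃ C : ℝ, ∀ x : ℝ, ‖fourierHat ψ x‖ * (1 + |x|) ^ α ≤ C
  polynomial : ∀ m : ℕ, m < N → ∃ p : Polynomial ℝ, p.degree = m ∧
    ∀ᵐ t : ℝ, ∑' k : ℤ, (k : ℝ) ^ m * φ (t - k) = p.eval t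

/-! ### The pyramidal algorithm -/

/-- The low-pass filter `u_k = 2^{-1/2} ∫ φ(t/2) φ(t-k) dt`. -/
def lowPass (φ : ℝ → ℝ) (k : ℤ) : ℝ :=
  (2 : ℝ) ^ (-(1 / 2) : ℝ) * ∫ t : ℝ, φ (t / 2) * φ (t - k)

/-- The high-pass filter `v_k = 2^{-1/2} ∫ ψ(t/2) φ(t-k) dt`. -/
def highPass (φ ψ : ℝ → ℝ) (k : ℤ) : ℝ :=
  (2 : ℝ) ^ (-(1 / 2) : ℝ) * ∫ t : ℝ, ψ (t / 2) * φ (t - k)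

/-- The approximation coefficients `a(2^j, k)` of the time series `x`: `a(2^0, k) = x(k)` and
`a(2^{j+1}, k) = ∑_{k'} u_{k'-2k} a(2^j, k')`. -/
def approxCoeff (φ : ℝ → ℝ) (x : ℤ → ℝ) : ℕ → ℤ → ℝ
  | 0, k => x k
  | j + 1, k => ∑' k' : ℤ, lowPass φ (k' - 2 * k) * approxCoeff φ x j k'

/-- The wavelet (detail) coefficients `d(2^j, k)` of the time series `x`, for octaves `j ≥ 1`:
`d(2^{j+1}, k) = ∑_{k'} v_{k'-2k} a(2^j, k')`. The value at `j = 0` is a placeholder. -/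
def detailCoeff (φ ψ : ℝ → ℝ) (x : ℤ → ℝ) : ℕ → ℤ → ℝ
  | 0, _ => 0
  | j + 1, k => ∑' k' : ℤ, highPass φ ψ (k' - 2 * k) * approxCoeff φ x j k'

/-- The wavelet coefficient `d(2^j, k)` of the discrete time samples `B(ℓ)`, `ℓ ∈ ℤ`, of a
process `B`. -/
def waveletCoeff {Ω : Type*} (φ ψ : ℝ → ℝ) (B : ℝ → Ω → ℝ) (j : ℕ) (k : ℤ) (ω : Ω) : ℝ :=
  detailCoeff φ ψ (fun l : ℤ => B (l : ℝ) ω) j k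

/-- `h_{j,ℓ} = 2^{-j/2} ∫ φ(t+ℓ) ψ(2^{-j} t) dt`. -/
def filterCoeff (φ ψ : ℝ → ℝ) (j : ℕ) (l : ℤ) : ℝ :=
  (2 : ℝ) ^ (-(j : ℝ) / 2) * ∫ t : ℝ, φ (t + l) * ψ ((2 : ℝ) ^ (-(j : ℤ)) * t)

/-- `𝓗_j(x) = ∑_ℓ h_{j,ℓ} e^{ixℓ}`. -/
def filterTransform (φ ψ : ℝ → ℝ) (j : ℕ) (x : ℝ) : ℂ :=
  ∑' l : ℤ, (filterCoeff φ ψ j l : ℂ) * Complex.exp (Complex.I * x * l)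

end TFBM

end

noncomputable section

namespace TFBM

/-! ### Filters of the pyramidal algorithm from the multiresolution analysis. -/

section MultiresolutionAnalysis

/-! Since `φ_{j+1,k}` and `ψ_{j+1,k}` lie in `V_j` and everything has compact support, they are
finite combinations of the `φ_{j,k'}` with coefficients `u_{k'-2k}` and `v_{k'-2k}`. Iterating, the
pyramidal algorithm collapses to the finite sum `d(2^j,k) = ∑ h_{j,2^j k-l} B(l)`
(`detailCoeff_eq_tsum`).

The Wiener isometry writes the covariance of `B(a)` and `B(b)` as `σ² (ρ(b-a) - ρ(-a) - ρ(b) +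
ρ(0))`, where `ρ` is the autocorrelation of the tempered power. The filter `h_j` sums to zero,
because the integer shifts of `φ` add up to a constant and `∫ ψ = 0` (`tsum_filterCoeff_eq_zero`).
Hence only the stationary term `ρ(b-a)` survives (`integral_waveletCoeff_mul`). The Laplace
transform of the tempered power gives the Fourier transform of `ρ` as `Γ(H+1/2)²
(λ²+x²)^{-(H+1/2)}`, and sampling at the integers periodizes it
(`integral_temperedPower_mul_comp_add_int`). This yields the covariance and the spectrum.

For the limit, Parseval in `V_0` identifies the Fourier coefficients of `|𝓗_j|²/2π` (normalized to
total mass one) with the autocorrelation of `ψ` at `2^{-j} m`, up to sign of the argument. These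
tend to `∫ ψ² = 1` for each `m`, so the probability measures `|𝓗_j|² dx / 2π` on the circle converge
weakly to the point mass at `0` (`tendsto_integral_norm_sq_filterTransform_mul`). Testing against
the continuous periodized density leaves its value at `0`. -/

theorem eq_sum_of_mem_closure_span {E ι : Type*} [NormedAddCommGroup E]
    [InnerProductSpace ℝ E] [CompleteSpace E] {e : ι → E} (he : Orthonormal ℝ e) {f : E}
    (hf : f ∈ (Submodule.span ℝ (Set.range e)).topologicalClosure) (s : Finset ι)
    (hs : ∀ i ∉ s, inner ℝ (e i) f = 0) : f = ∑ i ∈ s, inner ℝ (e i) f • e i := by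
  classical
  set g := f - ∑ i ∈ s, inner ℝ (e i) f • e i with hg
  have hgm : g ∈ (Submodule.span ℝ (Set.range e)).topologicalClosure := by
    refine Submodule.sub_mem _ hf (Submodule.sum_mem _ fun i _ => Submodule.smul_mem _ _ ?_)
    exact Submodule.le_topologicalClosure _ (Submodule.subset_span ⟨i, rfl⟩)
  -- The remainder `g` lies in the closed span and is orthogonal to it, hence to itself.
  have hgo : g ∈ (Submodule.span ℝ (Set.range e))ᗮ := by
    rw [Submodule.mem_orthogonal]
    intro u hu
    induction hu using Submodule.span_induction with
    | mem x hx =>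
      obtain ⟨i, rfl⟩ := hx
      by_cases hi : i ∈ s
      · rw [hg, inner_sub_right, he.inner_right_sum _ hi, sub_self]
      · rw [hg, inner_sub_right, hs i hi, inner_sum, zero_sub, neg_eq_zero]
        refine Finset.sum_eq_zero fun k hk => ?_
        rw [inner_smul_right, he.2 (fun h : i = k => hi (h ▸ hk)), mul_zero]
    | zero => simp
    | add x y _ _ hx hy => rw [inner_add_left, hx, hy, add_zero]
    | smul a x _ hx => rw [inner_smul_left, hx, mul_zero]
  rw [← Submodule.orthogonal_closure] at hgo
  have : inner ℝ g g = 0 := (Submodule.mem_orthogonal _ _).1 hgo g hgm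
  rw [inner_self_eq_zero] at this
  exact sub_eq_zero.1 this

theorem inner_toLp {f g : ℝ → ℝ} (hf : MemLp f 2 volume) (hg : MemLp g 2 volume) :
    inner ℝ (hf.toLp f) (hg.toLp g) = ∫ t, f t * g t := by
  rw [L2.inner_def]
  refine integral_congr_ae ?_
  filter_upwards [hf.coeFn_toLp, hg.coeFn_toLp] with t h1 h2
  rw [h1, h2]
  simp [mul_comm]

theorem inner_dyadicLp {f g : ℝ → ℝ} (hf : MemLp f 2 volume) (hg : MemLp g 2 volume)
    (j k j' k' : ℤ) :
    inner ℝ (dyadicLp hf j k) (dyadicLp hg j' k') = ∫ t, dyadic f j k t * dyadic g j' k' t :=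
  inner_toLp _ _

/-- The substitution `y = 2^{-j} t - 2k` removes `j`, which is why one filter serves all octaves.
For `f = φ` the right-hand side is definitionally the low-pass filter. -/
theorem inner_dyadicLp_succ {f φ : ℝ → ℝ} (hf : MemLp f 2 volume) (hφ : MemLp φ 2 volume)
    (j k k' : ℤ) :
    inner ℝ (dyadicLp hf (j + 1) k) (dyadicLp hφ j k') = highPass φ f (k' - 2 * k) := by
  rw [inner_dyadicLp, highPass]
  have h2 : (0 : ℝ) < 2 ^ j := by positivity
  have e : ∀ t : ℝ, dyadic f (j + 1) k t * dyadic φ j k' t =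
      ((2 : ℝ) ^ (-j) * (2 : ℝ) ^ (-(1 / 2) : ℝ)) *
        (fun y : ℝ => f (y / 2) * φ (y - ((k' - 2 * k : ℤ) : ℝ))) ((2 : ℝ) ^ (-j) * t - 2 * k) := by
    intro t
    have e1 : (2 : ℝ) ^ (-(j + 1)) * t - k = ((2 : ℝ) ^ (-j) * t - 2 * k) / 2 := by
      rw [neg_add, zpow_add₀ two_ne_zero]; simp only [zpow_neg_one]; ring
    have e2 : (2 : ℝ) ^ (-j) * t - k' =
        (2 : ℝ) ^ (-j) * t - 2 * k - ((k' - 2 * k : ℤ) : ℝ) := by push_cast; ring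
    have e3 : (2 : ℝ) ^ (-(((j + 1 : ℤ)) : ℝ) / 2) * (2 : ℝ) ^ (-(j : ℝ) / 2) =
        (2 : ℝ) ^ (-j) * (2 : ℝ) ^ (-(1 / 2) : ℝ) := by
      rw [← Real.rpow_intCast, ← Real.rpow_add two_pos, ← Real.rpow_add two_pos]
      congr 1; push_cast; ring
    simp only [dyadic]
    rw [e1, e2, ← e3]; ring
  simp_rw [e]
  rw [integral_const_mul, Measure.integral_comp_mul_left
    (fun x => (fun y : ℝ => f (y / 2) * φ (y - ((k' - 2 * k : ℤ) : ℝ))) (x - 2 * k)),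
    integral_sub_right_eq_self (fun y : ℝ => f (y / 2) * φ (y - ((k' - 2 * k : ℤ) : ℝ)))]
  rw [abs_of_pos (by positivity), smul_eq_mul, ← mul_assoc]
  congr 1
  field_simp

theorem inner_dyadicLp_zero {f φ : ℝ → ℝ} (hf : MemLp f 2 volume) (hφ : MemLp φ 2 volume)
    (j : ℕ) (k l : ℤ) :
    inner ℝ (dyadicLp hf j k) (dyadicLp hφ 0 l) = filterCoeff φ f j (2 ^ j * k - l) := by
  rw [inner_dyadicLp, filterCoeff, ← integral_const_mul]
  refine Eq.trans ?_ (integral_sub_right_eq_self (fun t : ℝ => (2 : ℝ) ^ (-(j : ℝ) / 2) *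
    (φ (t + ((2 ^ j * k - l : ℤ) : ℝ)) * f ((2 : ℝ) ^ (-(j : ℤ)) * t))) ((2 : ℝ) ^ j * k))
  congr 1
  ext t
  have e1 : (2 : ℝ) ^ (-(j : ℤ)) * t - k = (2 : ℝ) ^ (-(j : ℤ)) * (t - (2 : ℝ) ^ j * k) := by
    rw [zpow_neg, zpow_natCast]; field_simp
  have e2 : (2 : ℝ) ^ (-(0 : ℤ)) * t - l = t - (2 : ℝ) ^ j * k + ((2 ^ j * k - l : ℤ) : ℝ) := by
    push_cast; simp
  simp only [dyadic]
  rw [e1, e2]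
  simp
  ring

/-- The vanishing is pointwise, with a set of shifts independent of `t`, so that sums over shifts
can also be truncated under an integral. -/
theorem exists_finset_forall_mul_sub_eq_zero {f g : ℝ → ℝ} (hf : HasCompactSupport f)
    (hg : HasCompactSupport g) :
    ∃ s : Finset ℤ, ∀ l ∉ s, ∀ t : ℝ, f t * g (t - l) = 0 := by
  obtain ⟨R, hR⟩ := hf.isCompact.isBounded.exists_norm_le
  obtain ⟨R', hR'⟩ := hg.isCompact.isBounded.exists_norm_le
  refine ⟨Finset.Icc (-⌈R + R'⌉) ⌈R + R'⌉, fun l hl t => ?_⟩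
  by_contra ht
  have h1 := hR t (subset_tsupport f (left_ne_zero_of_mul ht))
  have h2 := hR' (t - l) (subset_tsupport g (right_ne_zero_of_mul ht))
  apply hl
  rw [Real.norm_eq_abs, abs_le] at h1 h2
  have h3 := Int.le_ceil (R + R')
  rw [Finset.mem_Icc]
  constructor
  · have : (-⌈R + R'⌉ : ℝ) ≤ l := by linarith
    exact_mod_cast this
  · have : (l : ℝ) ≤ ⌈R + R'⌉ := by linarith
    exact_mod_cast this

theorem finite_support_integral_mul_sub {f g : ℝ → ℝ} (hf : HasCompactSupport f)
    (hg : HasCompactSupport g) :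
    {l : ℤ | ∫ t, f t * g (t - l) ≠ 0}.Finite := by
  obtain ⟨s, hs⟩ := exists_finset_forall_mul_sub_eq_zero hf hg
  refine s.finite_toSet.subset fun l hl => ?_
  by_contra h
  exact hl (by simp [hs l h])

theorem _root_.HasCompactSupport.comp_zpow_mul {f : ℝ → ℝ} (hf : HasCompactSupport f) (j : ℤ) :
    HasCompactSupport fun t : ℝ => f ((2 : ℝ) ^ j * t) :=
  hf.comp_homeomorph (Homeomorph.mulLeft₀ ((2 : ℝ) ^ j) (by positivity))

theorem finite_support_highPass {f φ : ℝ → ℝ} (hf : HasCompactSupport f)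
    (hφ : HasCompactSupport φ) : (Function.support (highPass φ f)).Finite := by
  have hf' : HasCompactSupport fun t : ℝ => f (t / 2) := by
    simpa [div_eq_inv_mul] using! hf.comp_homeomorph (Homeomorph.mulLeft₀ (2⁻¹ : ℝ) (by norm_num))
  refine (finite_support_integral_mul_sub hf' hφ).subset fun k hk => ?_
  exact right_ne_zero_of_mul hk

theorem finite_support_filterCoeff {f φ : ℝ → ℝ} (hf : HasCompactSupport f)
    (hφ : HasCompactSupport φ) (j : ℕ) : (Function.support (filterCoeff φ f j)).Finite := by
  refine ((finite_support_integral_mul_sub (hf.comp_zpow_mul (-(j : ℤ))) hφ).image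
    (fun k => -k)).subset fun k hk => ?_
  refine ⟨-k, ?_, neg_neg k⟩
  have := right_ne_zero_of_mul hk
  simpa [mul_comm] using this

theorem summable_filterCoeff_mul {f φ : ℝ → ℝ} (hf : HasCompactSupport f)
    (hφ : HasCompactSupport φ) (j : ℕ) (m : ℤ) (x : ℤ → ℝ) :
    Summable fun l => filterCoeff φ f j (m - l) * x l := by
  refine summable_of_hasFiniteSupport ?_
  refine ((finite_support_filterCoeff hf hφ j).image (fun l => m - l)).subset fun l hl => ?_
  exact ⟨m - l, left_ne_zero_of_mul hl, by simp⟩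

/-- Expanding `f_{j+1,k}` in the basis `φ_{j,k'}` of `V_j` and pairing with `φ_{0,l}` gives the
recursion for the composed filters. Leaving `f` free covers both the low-pass (`f = φ`) and the
high-pass (`f = ψ`) step. -/
theorem tsum_highPass_mul_tsum {f φ : ℝ → ℝ} (hf : MemLp f 2 volume) (hφ : MemLp φ 2 volume)
    (hfc : HasCompactSupport f) (hφc : HasCompactSupport φ)
    (ho : ∀ j : ℤ, Orthonormal ℝ (dyadicLp hφ j))
    (hm : ∀ j k : ℤ, dyadicLp hf (j + 1) k ∈ dyadicSpan hφ j) (x : ℤ → ℝ) (j : ℕ) (k : ℤ) :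
    ∑' k' : ℤ, highPass φ f (k' - 2 * k) * ∑' l, filterCoeff φ φ j (2 ^ j * k' - l) * x l =
      ∑' l, filterCoeff φ f (j + 1) (2 ^ (j + 1) * k - l) * x l := by
  classical
  have hfin : (Function.support fun k' : ℤ => highPass φ f (k' - 2 * k)).Finite := by
    refine ((finite_support_highPass hfc hφc).image (fun l => l + 2 * k)).subset fun l hl => ?_
    exact ⟨l - 2 * k, hl, by simp⟩
  have hz : ∀ k' ∉ hfin.toFinset, highPass φ f (k' - 2 * k) = 0 := by
    intro k' hk'
    simpa using hk'
  rw [tsum_eq_sum (s := hfin.toFinset) (fun k' hk' => by rw [hz k' hk', zero_mul])]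
  simp_rw [← tsum_mul_left]
  rw [← Summable.tsum_finsetSum
    (fun k' _ => (summable_filterCoeff_mul hφc hφc j _ x).mul_left _)]
  congr 1
  ext l
  have h1 := inner_dyadicLp_zero hf hφ (j + 1) k l
  push_cast at h1
  have h2 := eq_sum_of_mem_closure_span (ho j) (hm j k) hfin.toFinset (by
    intro k' hk'
    rw [real_inner_comm, inner_dyadicLp_succ, hz k' hk'])
  rw [← h1, h2, sum_inner, Finset.sum_mul]
  refine Finset.sum_congr rfl fun k' _ => ?_
  rw [inner_smul_left, ← inner_dyadicLp_zero hφ hφ, real_inner_comm (dyadicLp hf _ _),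
    inner_dyadicLp_succ]
  simp [mul_assoc]

variable {φ ψ : ℝ → ℝ} {N : ℕ}

theorem dyadicLp_mem_dyadicSpan {f : ℝ → ℝ} (hf : MemLp f 2 volume) (j k : ℤ) :
    dyadicLp hf j k ∈ dyadicSpan hf j :=
  Submodule.le_topologicalClosure _ (Submodule.subset_span ⟨k, rfl⟩)

theorem IsMRA.dyadicLp_psi_mem (h : IsMRA φ ψ) (j k : ℤ) :
    dyadicLp h.memLp_psi (j + 1) k ∈ dyadicSpan h.memLp_phi j := by
  have := dyadicLp_mem_dyadicSpan h.memLp_psi (j + 1) k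
  rw [h.detail] at this
  exact this.2

theorem IsMRA.dyadicSpan_le_zero (h : IsMRA φ ψ) (j : ℕ) :
    dyadicSpan h.memLp_phi j ≤ dyadicSpan h.memLp_phi 0 := by
  induction j with
  | zero => exact le_rfl
  | succ j ih => exact le_trans (by simpa using h.nested j) ih

/-- Induction on the octave; at `j = 0` orthonormality of the integer shifts of `φ` makes the filter
a Kronecker delta. -/
theorem approxCoeff_eq_tsum (h : IsAdmissibleWavelet φ ψ N) (x : ℤ → ℝ) (j : ℕ) (k : ℤ) :
    approxCoeff φ x j k = ∑' l, filterCoeff φ φ j (2 ^ j * k - l) * x l := by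
  induction j generalizing k with
  | zero =>
    have h1 := fun l => inner_dyadicLp_zero h.mra.memLp_phi h.mra.memLp_phi 0 k l
    simp_rw [← h1, approxCoeff]
    rw [tsum_eq_single k]
    · have := (h.mra.orthonormal_phi 0).1 k
      simp [this]
    · intro l hl
      have := (h.mra.orthonormal_phi 0).2 hl.symm
      simp [this]
  | succ j ih =>
    simp_rw [approxCoeff, ih]
    exact tsum_highPass_mul_tsum h.mra.memLp_phi h.mra.memLp_phi h.compact_phi h.compact_phi
      h.mra.orthonormal_phi
      (fun j k => h.mra.nested j (dyadicLp_mem_dyadicSpan h.mra.memLp_phi (j + 1) k)) x j k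

/-- The wavelet coefficients are finite linear combinations of the observations. -/
theorem detailCoeff_eq_tsum (h : IsAdmissibleWavelet φ ψ N) (x : ℤ → ℝ) {j : ℕ} (hj : 1 ≤ j)
    (k : ℤ) : detailCoeff φ ψ x j k = ∑' l, filterCoeff φ ψ j (2 ^ j * k - l) * x l := by
  obtain ⟨j, rfl⟩ := Nat.exists_eq_add_of_le' hj
  simp_rw [detailCoeff, approxCoeff_eq_tsum h]
  exact tsum_highPass_mul_tsum h.mra.memLp_psi h.mra.memLp_phi h.compact_psi h.compact_phi
    h.mra.orthonormal_phi h.mra.dyadicLp_psi_mem x j k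

/-- Summing under the integral replaces the shifts of `φ` by a constant, the degree-zero case of
polynomial reproduction, and leaves a multiple of `∫ ψ = 0`. -/
theorem tsum_filterCoeff_eq_zero (h : IsAdmissibleWavelet φ ψ N) (j : ℕ) :
    ∑' l, filterCoeff φ ψ j l = 0 := by
  obtain ⟨s, hs⟩ :=
    exists_finset_forall_mul_sub_eq_zero (h.compact_psi.comp_zpow_mul (-(j : ℤ))) h.compact_phi
  obtain ⟨p, hp, hpt⟩ := h.polynomial 0 h.one_le
  obtain ⟨c, rfl⟩ := Polynomial.natDegree_eq_zero.1 (Polynomial.natDegree_eq_of_degree_eq_some hp)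
  have hψ : MemLp (fun t : ℝ => ψ ((2 : ℝ) ^ (-(j : ℤ)) * t)) 2 volume := by
    have := (memLp_dyadic h.mra.memLp_psi j 0).const_mul ((2 : ℝ) ^ ((j : ℝ) / 2))
    refine this.ae_eq (Eventually.of_forall fun t => ?_)
    simp only [dyadic]
    rw [← mul_assoc, ← Real.rpow_add two_pos]
    simp [neg_div]
  have hφ (l : ℤ) : MemLp (fun t : ℝ => φ (t - l)) 2 volume :=
    h.mra.memLp_phi.comp_measurePreserving (measurePreserving_sub_right volume (l : ℝ))
  rw [← (Equiv.neg ℤ).tsum_eq, tsum_eq_sum (s := s)]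
  · simp only [Equiv.neg_apply, filterCoeff]
    rw [← Finset.mul_sum]
    have e : ∀ l : ℤ, ∫ t : ℝ, φ (t + ((-l : ℤ) : ℝ)) * ψ ((2 : ℝ) ^ (-(j : ℤ)) * t) =
        ∫ t : ℝ, ψ ((2 : ℝ) ^ (-(j : ℤ)) * t) * φ (t - l) := fun l => by
      congr 1; ext t; push_cast; rw [mul_comm, ← sub_eq_add_neg]
    simp_rw [e]
    have hi (l : ℤ) : Integrable fun t : ℝ => ψ ((2 : ℝ) ^ (-(j : ℤ)) * t) * φ (t - l) :=
      hψ.integrable_mul (hφ l)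
    rw [← integral_finsetSum s fun l _ => hi l]
    have e2 : ∫ t : ℝ, ∑ l ∈ s, ψ ((2 : ℝ) ^ (-(j : ℤ)) * t) * φ (t - l) =
        ∫ t : ℝ, ψ ((2 : ℝ) ^ (-(j : ℤ)) * t) * c := by
      refine integral_congr_ae ?_
      filter_upwards [hpt] with t ht
      rw [← tsum_eq_sum (L := SummationFilter.unconditional ℤ) fun l hl => hs l hl t,
        tsum_mul_left]
      simp only [pow_zero, one_mul, Polynomial.eval_C] at ht
      rw [ht]
    rw [e2, integral_mul_const, Measure.integral_comp_mul_left ψ]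
    have := h.moment_eq_zero 0 h.one_le
    simp only [pow_zero, one_mul] at this
    simp [this]
  · intro l hl
    simp only [Equiv.neg_apply, filterCoeff]
    have e : ∀ t : ℝ, φ (t + ((-l : ℤ) : ℝ)) * ψ ((2 : ℝ) ^ (-(j : ℤ)) * t) = 0 := fun t => by
      rw [mul_comm]; simpa [← sub_eq_add_neg] using hs l hl t
    simp_rw [e]
    simp

/-- The autocorrelation of the filter `h_j` is the autocorrelation of the wavelet at the points
`2^{-j} m`, because `ψ_{j,0}` lies in `V_0`. -/
theorem tsum_filterCoeff_mul_filterCoeff (h : IsAdmissibleWavelet φ ψ N) {j : ℕ} (hj : 1 ≤ j)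
    (m : ℤ) : ∑' l, filterCoeff φ ψ j l * filterCoeff φ ψ j (l + m) =
      ∫ t, ψ t * ψ (t + -((2 : ℝ) ^ (-(j : ℤ)) * m)) := by
  have hψ := h.mra.memLp_psi
  -- A shift by `m` need not be a multiple of `2^j`, so the translate is in general not one of the
  -- `ψ_{j,k}`. Only the unshifted factor has to be expanded in `V_0`.
  have hg : MemLp (fun t : ℝ => dyadic ψ j 0 (t - m)) 2 volume :=
    (memLp_dyadic hψ j 0).comp_measurePreserving (measurePreserving_sub_right volume (m : ℝ))
  have hmem : dyadicLp hψ j 0 ∈ dyadicSpan h.mra.memLp_phi 0 := by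
    obtain ⟨j, rfl⟩ := Nat.exists_eq_add_of_le' hj
    exact h.mra.dyadicSpan_le_zero j (by simpa using h.mra.dyadicLp_psi_mem j 0)
  have h1 (l : ℤ) : inner ℝ (dyadicLp hψ j 0) (dyadicLp h.mra.memLp_phi 0 (-l)) =
      filterCoeff φ ψ j l := by
    simpa using inner_dyadicLp_zero hψ h.mra.memLp_phi j 0 (-l)
  have h2 (l : ℤ) : inner ℝ (dyadicLp h.mra.memLp_phi 0 (-l)) (hg.toLp _) =
      filterCoeff φ ψ j (l + m) := by
    rw [dyadicLp, inner_toLp, filterCoeff, ← integral_const_mul]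
    refine Eq.trans ?_ (integral_sub_right_eq_self (fun t : ℝ => (2 : ℝ) ^ (-(j : ℝ) / 2) *
      (φ (t + ((l + m : ℤ) : ℝ)) * ψ ((2 : ℝ) ^ (-(j : ℤ)) * t))) (m : ℝ))
    congr 1
    ext t
    simp only [dyadic]
    have e : t - m + ((l + m : ℤ) : ℝ) = t + l := by push_cast; ring
    rw [e]
    simp
    ring
  have hfin := finite_support_filterCoeff h.compact_psi h.compact_phi j
  have hs : ∀ l ∉ hfin.toFinset, filterCoeff φ ψ j l = 0 := by
    intro l hl
    simpa using hl
  have h3 := eq_sum_of_mem_closure_span (h.mra.orthonormal_phi 0) hmem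
    (hfin.toFinset.map (Equiv.neg ℤ).toEmbedding) (by
      intro i hi
      have h4 := h1 (-i)
      rw [neg_neg] at h4
      rw [real_inner_comm, h4]
      refine hs _ fun h5 => hi ?_
      rw [Finset.mem_map]
      exact ⟨-i, h5, by simp⟩)
  rw [tsum_eq_sum (s := hfin.toFinset) fun l hl => by rw [hs l hl, zero_mul]]
  have h5 : inner ℝ (dyadicLp hψ j 0) (hg.toLp _) =
      ∑ l ∈ hfin.toFinset, filterCoeff φ ψ j l * filterCoeff φ ψ j (l + m) := by
    conv_lhs => rw [h3]
    rw [Finset.sum_map, sum_inner]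
    refine Finset.sum_congr rfl fun l _ => ?_
    rw [inner_smul_left, real_inner_comm]
    simp only [Equiv.coe_toEmbedding, Equiv.neg_apply, conj_trivial]
    rw [h1, h2]
  rw [← h5, dyadicLp, inner_toLp]
  have e : ∀ t : ℝ, dyadic ψ j 0 t * dyadic ψ j 0 (t - m) = (2 : ℝ) ^ (-(j : ℤ)) *
      (fun y : ℝ => ψ y * ψ (y + -((2 : ℝ) ^ (-(j : ℤ)) * m))) ((2 : ℝ) ^ (-(j : ℤ)) * t) := by
    intro t
    have e3 : (2 : ℝ) ^ (-(((j : ℤ)) : ℝ) / 2) * (2 : ℝ) ^ (-(((j : ℤ)) : ℝ) / 2) =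
        (2 : ℝ) ^ (-(j : ℤ)) := by
      rw [← Real.rpow_intCast, ← Real.rpow_add two_pos]
      congr 1; push_cast; ring
    simp only [dyadic]
    rw [← e3, mul_sub, Int.cast_zero, sub_zero, sub_zero, e3, ← sub_eq_add_neg, ← e3]
    ring
  simp_rw [e]
  rw [integral_const_mul, Measure.integral_comp_mul_left
    (fun y : ℝ => ψ y * ψ (y + -((2 : ℝ) ^ (-(j : ℤ)) * m))), abs_of_pos (by positivity),
    smul_eq_mul, ← mul_assoc, mul_inv_cancel₀ (by positivity), one_mul]

end MultiresolutionAnalysis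

/-! ### The Wiener isometry. -/

section StochasticIntegral

variable {Ω : Type*} [MeasurableSpace Ω] {P : Measure Ω} {σ : ℝ} {M : Set ℝ → Ω → ℝ}

theorem IsGaussianRandomMeasure.memLp (hM : IsGaussianRandomMeasure P σ M) {A : Set ℝ}
    (hA : MeasurableSet A) (hA' : volume A ≠ ⊤) : MemLp (M A) 2 P := by
  have h := memLp_id_gaussianReal' (μ := 0) (v := Real.toNNReal (σ ^ 2 * volume.real A)) 2 (by simp)
  rw [← hM.gaussian A hA hA'] at h
  exact h.comp_of_map (hM.aemeasurable A hA hA')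

theorem IsGaussianRandomMeasure.integral_eq_zero (hM : IsGaussianRandomMeasure P σ M) {A : Set ℝ}
    (hA : MeasurableSet A) (hA' : volume A ≠ ⊤) : ∫ ω, M A ω ∂P = 0 := by
  have h := integral_id_gaussianReal (μ := 0) (v := Real.toNNReal (σ ^ 2 * volume.real A))
  rw [← hM.gaussian A hA hA'] at h
  exact (integral_map (f := id) (hM.aemeasurable A hA hA') aestronglyMeasurable_id).symm.trans h

theorem IsGaussianRandomMeasure.integral_sq (hM : IsGaussianRandomMeasure P σ M) {A : Set ℝ}
    (hA : MeasurableSet A) (hA' : volume A ≠ ⊤) :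
    ∫ ω, M A ω * M A ω ∂P = σ ^ 2 * volume.real A := by
  have h := variance_id_gaussianReal (μ := 0) (v := Real.toNNReal (σ ^ 2 * volume.real A))
  rw [← hM.gaussian A hA hA', variance_map aemeasurable_id (hM.aemeasurable A hA hA'),
    variance_of_integral_eq_zero (by simpa using hM.aemeasurable A hA hA')
      (by simpa using hM.integral_eq_zero hA hA')] at h
  rw [Real.coe_toNNReal _ (by positivity)] at h
  rw [← h]
  simp [sq]

theorem IsGaussianRandomMeasure.empty_ae (hM : IsGaussianRandomMeasure P σ M) :
    M ∅ =ᵐ[P] 0 := by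
  have h := hM.gaussian ∅ MeasurableSet.empty (by simp)
  simp only [measureReal_empty, mul_zero, Real.toNNReal_zero, gaussianReal_zero_var] at h
  have h2 : ∀ᵐ x ∂(P.map (M ∅)), x = 0 := by
    rw [h, ae_dirac_iff (p := fun x : ℝ => x = 0) (measurableSet_singleton 0)]
  exact ae_of_ae_map (hM.aemeasurable ∅ MeasurableSet.empty (by simp)) h2

/-- The sequence of sets `A, B, ∅, ∅, …`. -/
def pairSeq (A B : Set ℝ) : ℕ → Set ℝ
  | 0 => A
  | 1 => B
  | _ + 2 => ∅

theorem measurableSet_pairSeq {A B : Set ℝ} (hA : MeasurableSet A) (hB : MeasurableSet B) :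
    ∀ i, MeasurableSet (pairSeq A B i)
  | 0 => hA
  | 1 => hB
  | _ + 2 => MeasurableSet.empty

theorem pairwise_disjoint_pairSeq {A B : Set ℝ} (h : Disjoint A B) :
    Pairwise fun i j => Disjoint (pairSeq A B i) (pairSeq A B j)
  | 0, 0, hij => absurd rfl hij
  | 0, 1, _ => h
  | 1, 0, _ => h.symm
  | 1, 1, hij => absurd rfl hij
  | _ + 2, _, _ => by simp [pairSeq]
  | _, _ + 2, _ => by simp [pairSeq]

theorem iUnion_pairSeq (A B : Set ℝ) : ⋃ i, pairSeq A B i = A ∪ B := by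
  ext x
  simp only [Set.mem_iUnion, Set.mem_union]
  constructor
  · rintro ⟨i, hi⟩
    match i, hi with
    | 0, hi => exact Or.inl hi
    | 1, hi => exact Or.inr hi
  · rintro (h | h)
    exacts [⟨0, h⟩, ⟨1, h⟩]

/-- Countable additivity applied to `A, B, ∅, ∅, …`: almost surely the partial sums are constant
from the second one on. -/
theorem IsGaussianRandomMeasure.union_ae (hM : IsGaussianRandomMeasure P σ M) {A B : Set ℝ}
    (hA : MeasurableSet A) (hB : MeasurableSet B) (hA' : volume A ≠ ⊤) (hB' : volume B ≠ ⊤)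
    (h : Disjoint A B) : M (A ∪ B) =ᵐ[P] M A + M B := by
  have h1 := hM.additive (pairSeq A B) (measurableSet_pairSeq hA hB)
    (pairwise_disjoint_pairSeq h)
  rw [iUnion_pairSeq] at h1
  filter_upwards [h1 (measure_union_ne_top hA' hB'), hM.empty_ae] with ω h2 h3
  refine tendsto_nhds_unique h2 (tendsto_const_nhds.congr' ?_)
  filter_upwards [eventually_ge_atTop 2] with n hn
  obtain ⟨n, rfl⟩ := Nat.exists_eq_add_of_le' hn
  rw [Finset.sum_range_succ', Finset.sum_range_succ']
  simp only [pairSeq, h3, Pi.zero_apply, Finset.sum_const_zero, zero_add, Pi.add_apply]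
  ring

theorem IsGaussianRandomMeasure.integral_mul_of_disjoint (hM : IsGaussianRandomMeasure P σ M)
    {A B : Set ℝ} (hA : MeasurableSet A) (hB : MeasurableSet B) (hA' : volume A ≠ ⊤)
    (hB' : volume B ≠ ⊤) (h : Disjoint A B) : ∫ ω, M A ω * M B ω ∂P = 0 := by
  have h1 := (hM.independent (pairSeq A B) (measurableSet_pairSeq hA hB)
    (fun i => by match i with
      | 0 => exact hA'
      | 1 => exact hB'
      | _ + 2 => simp [pairSeq])
    (pairwise_disjoint_pairSeq h)).indepFun (zero_ne_one : (0 : ℕ) ≠ 1)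
  have h2 := h1.integral_mul_eq_mul_integral (hM.memLp hA hA').aestronglyMeasurable
    (hM.memLp hB hB').aestronglyMeasurable
  simpa [pairSeq, hM.integral_eq_zero hA hA'] using h2

/-- Splitting both sets along `A ∩ B`, all products over disjoint pieces have mean zero and only the
square of `M (A ∩ B)` contributes. -/
theorem IsGaussianRandomMeasure.integral_mul (hM : IsGaussianRandomMeasure P σ M)
    {A B : Set ℝ} (hA : MeasurableSet A) (hB : MeasurableSet B) (hA' : volume A ≠ ⊤)
    (hB' : volume B ≠ ⊤) : ∫ ω, M A ω * M B ω ∂P = σ ^ 2 * volume.real (A ∩ B) := by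
  have hI := hA.inter hB
  have hI' : volume (A ∩ B) ≠ ⊤ := measure_ne_top_of_subset Set.inter_subset_left hA'
  have split {C D : Set ℝ} (hC : MeasurableSet C) (hD : MeasurableSet D) (hC' : volume C ≠ ⊤) :
      M C =ᵐ[P] M (C ∩ D) + M (C \ D) := by
    conv_lhs => rw [← Set.inter_union_sdiff C D]
    exact hM.union_ae (hC.inter hD) (hC.diff hD)
      (measure_ne_top_of_subset Set.inter_subset_left hC')
      (measure_ne_top_of_subset Set.sdiff_subset hC')
      (Set.disjoint_sdiff_right.mono_left Set.inter_subset_right)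
  have hmul {C D : Set ℝ} (hC : MeasurableSet C) (hD : MeasurableSet D) (hC' : volume C ≠ ⊤)
      (hD' : volume D ≠ ⊤) : Integrable (fun ω => M C ω * M D ω) P :=
    (hM.memLp hC hC').integrable_mul (hM.memLp hD hD')
  have hAB := hA.diff hB
  have hAB' : volume (A \ B) ≠ ⊤ := measure_ne_top_of_subset Set.sdiff_subset hA'
  have hBA := hB.diff hA
  have hBA' : volume (B \ A) ≠ ⊤ := measure_ne_top_of_subset Set.sdiff_subset hB'
  have e1 : ∫ ω, M A ω * M B ω ∂P = ∫ ω, (M (A ∩ B) ω * M B ω + M (A \ B) ω * M B ω) ∂P := by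
    refine integral_congr_ae ?_
    filter_upwards [split hA hB hA'] with ω h1
    rw [h1, Pi.add_apply]; ring
  have e2 : ∫ ω, M (A ∩ B) ω * M B ω ∂P =
      ∫ ω, (M (A ∩ B) ω * M (A ∩ B) ω + M (A ∩ B) ω * M (B \ A) ω) ∂P := by
    refine integral_congr_ae ?_
    filter_upwards [split hB hA hB'] with ω h1
    rw [h1, Pi.add_apply, Set.inter_comm B A]; ring
  rw [e1, integral_add (hmul hI hB hI' hB') (hmul hAB hB hAB' hB'), e2,
    integral_add (hmul hI hI hI' hI') (hmul hI hBA hI' hBA'), hM.integral_sq hI hI',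
    hM.integral_mul_of_disjoint hAB hB hAB' hB' Set.disjoint_sdiff_left,
    hM.integral_mul_of_disjoint hI hBA hI' hBA'
      (Set.disjoint_sdiff_right.mono_left Set.inter_subset_left)]
  ring

/-- The pair of `1_A ∈ L²(ℝ)` and `M(A) ∈ L²(P)`. -/
def IsGaussianRandomMeasure.pair (hM : IsGaussianRandomMeasure P σ M)
    (A : {A : Set ℝ // MeasurableSet A ∧ volume A ≠ ⊤}) :
    Lp ℝ 2 (volume : Measure ℝ) × Lp ℝ 2 P :=
  (indicatorConstLp 2 A.2.1 A.2.2 1, (hM.memLp A.2.1 A.2.2).toLp _)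

/-- The graph of the Wiener integral, as the closed span of the pairs `(1_A, M(A))`. -/
def IsGaussianRandomMeasure.graph (hM : IsGaussianRandomMeasure P σ M) :
    Submodule ℝ (Lp ℝ 2 (volume : Measure ℝ) × Lp ℝ 2 P) :=
  (Submodule.span ℝ (Set.range hM.pair)).topologicalClosure

/-- One and the same step function approximates both components, so the definition says that the
pair is a limit in the sup metric of the product. -/
theorem IsStochasticIntegral.mem_graph (hM : IsGaussianRandomMeasure P σ M) {f : ℝ → ℝ}
    {X : Ω → ℝ} (h : IsStochasticIntegral P M f X) :
    (h.1.toLp f, h.2.1.toLp X) ∈ hM.graph := by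
  change _ ∈ closure _
  rw [EMetric.mem_closure_iff]
  intro ε hε
  obtain ⟨n, c, A, hA, hA', h1, h2⟩ := h.2.2 ε hε
  refine ⟨∑ i, c i • hM.pair ⟨A i, hA i, hA' i⟩,
    Submodule.sum_mem _ fun i _ => Submodule.smul_mem _ _ (Submodule.subset_span ⟨_, rfl⟩), ?_⟩
  rw [Prod.edist_eq, max_lt_iff, Prod.fst_sum, Prod.snd_sum]
  constructor
  · rw [Lp.edist_def]
    refine lt_of_eq_of_lt (eLpNorm_congr_ae ?_) h1
    have h3 : ∀ᵐ u, ∀ i, (indicatorConstLp 2 (hA i) (hA' i) (1 : ℝ)) u =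
        (A i).indicator (fun _ => (1 : ℝ)) u :=
      ae_all_iff.2 fun i => indicatorConstLp_coeFn
    have h5 : ∀ᵐ u, ∀ i, (c i • indicatorConstLp 2 (hA i) (hA' i) (1 : ℝ) :
        Lp ℝ 2 (volume : Measure ℝ)) u = c i * (indicatorConstLp 2 (hA i) (hA' i) (1 : ℝ)) u :=
      ae_all_iff.2 fun i => Lp.coeFn_smul _ _
    filter_upwards [h.1.coeFn_toLp, h3, h5, Lp.coeFn_finsetSum Finset.univ
      fun i => (c i • indicatorConstLp 2 (hA i) (hA' i) (1 : ℝ) : Lp ℝ 2 (volume : Measure ℝ))]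
      with u h6 h7 h8 h9
    simp only [IsGaussianRandomMeasure.pair, Prod.smul_fst, Pi.sub_apply]
    rw [h6, h9]
    simp [h7, h8]
  · rw [Lp.edist_def]
    refine lt_of_eq_of_lt (eLpNorm_congr_ae ?_) h2
    have h3 : ∀ᵐ ω ∂P, ∀ i, (hM.memLp (hA i) (hA' i)).toLp (M (A i)) ω = M (A i) ω :=
      ae_all_iff.2 fun i => (hM.memLp (hA i) (hA' i)).coeFn_toLp
    have h5 : ∀ᵐ ω ∂P, ∀ i, (c i • (hM.memLp (hA i) (hA' i)).toLp (M (A i)) : Lp ℝ 2 P) ω =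
        c i * (hM.memLp (hA i) (hA' i)).toLp (M (A i)) ω :=
      ae_all_iff.2 fun i => Lp.coeFn_smul _ _
    filter_upwards [h.2.1.coeFn_toLp, h3, h5, Lp.coeFn_finsetSum Finset.univ
      fun i => (c i • (hM.memLp (hA i) (hA' i)).toLp (M (A i)) : Lp ℝ 2 P)] with u h6 h7 h8 h9
    simp only [IsGaussianRandomMeasure.pair, Prod.smul_snd, Pi.sub_apply]
    rw [h6, h9]
    simp [h7, h8]

/-- The continuous symmetric form `⟨p₂,q₂⟩ - σ² ⟨p₁,q₁⟩` vanishes on the generating pairs.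
Closedness of its kernel extends this to the graph in one variable, then by symmetry in the other.
-/
theorem IsGaussianRandomMeasure.inner_of_mem_graph (hM : IsGaussianRandomMeasure P σ M)
    {p q : Lp ℝ 2 (volume : Measure ℝ) × Lp ℝ 2 P} (hp : p ∈ hM.graph) (hq : q ∈ hM.graph) :
    inner ℝ p.2 q.2 = σ ^ 2 * inner ℝ p.1 q.1 := by
  let T (p : Lp ℝ 2 (volume : Measure ℝ) × Lp ℝ 2 P) :
      (Lp ℝ 2 (volume : Measure ℝ) × Lp ℝ 2 P) →L[ℝ] ℝ :=
    (innerSL ℝ p.2).comp (ContinuousLinearMap.snd ℝ _ _) -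
      σ ^ 2 • (innerSL ℝ p.1).comp (ContinuousLinearMap.fst ℝ _ _)
  have hT (p q) : T p q = inner ℝ p.2 q.2 - σ ^ 2 * inner ℝ p.1 q.1 := rfl
  have key (p) (h : ∀ A, T p (hM.pair A) = 0) {q} (hq : q ∈ hM.graph) : T p q = 0 := by
    have : hM.graph ≤ (T p).ker := by
      refine Submodule.topologicalClosure_minimal _ (Submodule.span_le.2 ?_) (T p).isClosed_ker
      rintro _ ⟨A, rfl⟩
      exact h A
    exact this hq
  have h1 (A B) : T (hM.pair A) (hM.pair B) = 0 := by
    rw [hT]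
    simp only [pair]
    rw [L2.inner_indicatorConstLp_indicatorConstLp A.2.1 B.2.1 A.2.2 B.2.2, L2.inner_def]
    have : ∫ ω, inner ℝ ((hM.memLp A.2.1 A.2.2).toLp (M A) ω)
        ((hM.memLp B.2.1 B.2.2).toLp (M B) ω) ∂P = ∫ ω, M A ω * M B ω ∂P := by
      refine integral_congr_ae ?_
      filter_upwards [(hM.memLp A.2.1 A.2.2).coeFn_toLp, (hM.memLp B.2.1 B.2.2).coeFn_toLp]
        with ω h1 h2
      rw [h1, h2]
      simp [mul_comm]
    rw [this, hM.integral_mul A.2.1 B.2.1 A.2.2 B.2.2]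
    simp
  have h2 (p q) : T p q = T q p := by
    rw [hT, hT, real_inner_comm, real_inner_comm p.1]
  have h3 : T p q = 0 := key p (fun A => by rw [h2]; exact key _ (h1 A) hp) hq
  rw [hT] at h3
  linarith

/-- The Wiener isometry. -/
theorem IsStochasticIntegral.integral_mul (hM : IsGaussianRandomMeasure P σ M) {f g : ℝ → ℝ}
    {X Y : Ω → ℝ} (hX : IsStochasticIntegral P M f X) (hY : IsStochasticIntegral P M g Y) :
    ∫ ω, X ω * Y ω ∂P = σ ^ 2 * ∫ u, f u * g u := by
  have h := hM.inner_of_mem_graph (hX.mem_graph hM) (hY.mem_graph hM)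
  rw [inner_toLp, L2.inner_def] at h
  rw [← h]
  refine integral_congr_ae ?_
  filter_upwards [hX.2.1.coeFn_toLp, hY.2.1.coeFn_toLp] with ω h1 h2
  rw [h1, h2]
  simp [mul_comm]

/-- Under a probability measure the expectation is the inner product with the constant `1`, a
continuous functional that vanishes on the generators of the graph. -/
theorem IsStochasticIntegral.integral_eq_zero [IsProbabilityMeasure P]
    (hM : IsGaussianRandomMeasure P σ M) {f : ℝ → ℝ} {X : Ω → ℝ}
    (hX : IsStochasticIntegral P M f X) : ∫ ω, X ω ∂P = 0 := by
  have h1 : MemLp (fun _ : Ω => (1 : ℝ)) 2 P := memLp_const 1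
  let T : (Lp ℝ 2 (volume : Measure ℝ) × Lp ℝ 2 P) →L[ℝ] ℝ :=
    (innerSL ℝ (h1.toLp _)).comp (ContinuousLinearMap.snd ℝ _ _)
  have hT (q : Lp ℝ 2 (volume : Measure ℝ)) {Y : Ω → ℝ} (hY : MemLp Y 2 P) :
      T (q, hY.toLp Y) = ∫ ω, Y ω ∂P := by
    change inner ℝ (h1.toLp _) (hY.toLp Y) = _
    rw [L2.inner_def]
    refine integral_congr_ae ?_
    filter_upwards [h1.coeFn_toLp, hY.coeFn_toLp] with ω h1 h2
    rw [h1, h2]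
    simp
  have : hM.graph ≤ T.ker := by
    refine Submodule.topologicalClosure_minimal _ (Submodule.span_le.2 ?_) T.isClosed_ker
    rintro _ ⟨A, rfl⟩
    change T _ = 0
    rw [IsGaussianRandomMeasure.pair, hT, hM.integral_eq_zero A.2.1 A.2.2]
  have h2 := this (hX.mem_graph hM)
  change T _ = 0 at h2
  rwa [hT] at h2

end StochasticIntegral

/-! ### The tempered power, its Laplace transform, and the periodized spectral density. -/

section SpectralDensity

/-- The autocorrelation of a square integrable function is continuous. -/
theorem continuous_integral_mul_comp_add {f : ℝ → ℝ} (hf : MemLp f 2 volume) :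
    Continuous fun t : ℝ => ∫ x, f x * f (x + t) := by
  have : Fact ((2 : ENNReal) ≠ ⊤) := ⟨by simp⟩
  -- Translations act strongly continuously on `L²`.
  have h1 : Continuous fun t : ℝ => inner ℝ (hf.toLp f) (DomAddAct.mk t +ᵥ hf.toLp f) :=
    continuous_const.inner (DomAddAct.continuous_mk.vadd continuous_const)
  convert! h1 using 1
  ext t
  rw [DomAddAct.mk_vadd_toLp, inner_toLp]
  simp [add_comm]

theorem temperedPower_nonneg (H lam x : ℝ) : 0 ≤ temperedPower H lam x := by
  unfold temperedPower
  split_ifs with h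
  · positivity
  · exact le_rfl

theorem temperedPower_eq_indicator (H lam : ℝ) : temperedPower H lam =
    (Set.Ioi (0 : ℝ)).indicator fun x => Real.exp (-lam * x) * x ^ (H - 1 / 2) := by
  ext x
  simp [temperedPower, Set.indicator_apply]

theorem measurable_temperedPower (H lam : ℝ) : Measurable (temperedPower H lam) := by
  rw [temperedPower_eq_indicator]
  exact Measurable.indicator (by fun_prop) measurableSet_Ioi

theorem integrable_temperedPower {H lam : ℝ} (hH : 0 < H + 1 / 2) (hlam : 0 < lam) :
    Integrable (temperedPower H lam) volume := by
  rw [temperedPower_eq_indicator, integrable_indicator_iff measurableSet_Ioi]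
  refine (integrableOn_rpow_mul_exp_neg_mul_rpow (s := H - 1 / 2) (by linarith) one_pos
    hlam).congr_fun (fun x _ => ?_) measurableSet_Ioi
  simp [mul_comm]

theorem memLp_temperedPower {H lam : ℝ} (hH : 0 < H) (hlam : 0 < lam) :
    MemLp (temperedPower H lam) 2 volume := by
  rw [memLp_two_iff_integrable_sq (measurable_temperedPower H lam).aestronglyMeasurable]
  -- The square of a tempered power is again one, with parameters `2H - 1/2` and `2λ`; the former
  -- may be negative, but integrability only asks that it exceed `-1/2`.
  refine (integrable_temperedPower (H := 2 * H - 1 / 2) (lam := 2 * lam) (by linarith)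
    (by linarith)).congr (Eventually.of_forall fun x => ?_)
  simp only [temperedPower]
  split_ifs with hx
  · rw [mul_pow, ← Real.exp_nat_mul, ← Real.rpow_mul_natCast hx.le]
    push_cast
    congr 2 <;> ring_nf
  · simp

theorem integral_temperedPower {H lam : ℝ} (hH : 0 < H + 1 / 2) (hlam : 0 < lam) :
    ∫ x, temperedPower H lam x = (1 / lam) ^ (H + 1 / 2) * Real.Gamma (H + 1 / 2) := by
  rw [temperedPower_eq_indicator, integral_indicator measurableSet_Ioi,
    ← Real.integral_rpow_mul_exp_neg_mul_Ioi hH hlam]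
  refine setIntegral_congr_fun measurableSet_Ioi fun x _ => ?_
  ring_nf

theorem temperedPower_mul_exp (H lam t x : ℝ) :
    temperedPower H lam x * Real.exp (t * x) = temperedPower H (lam - t) x := by
  unfold temperedPower
  split_ifs
  · rw [mul_right_comm, ← Real.exp_add]
    ring_nf
  · simp

/-- The Laplace transform of the tempered power function in the half plane of convergence. -/
theorem integral_temperedPower_mul_cexp {H lam : ℝ} (hH : 0 < H + 1 / 2) {z : ℂ}
    (hz : z.re < lam) :
    ∫ x : ℝ, (temperedPower H lam x : ℂ) * Complex.exp (z * x) =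
      (1 / (lam - z)) ^ ((H + 1 / 2 : ℝ) : ℂ) * Real.Gamma (H + 1 / 2) := by
  -- With the tempered power as density, the integral becomes a complex moment generating function,
  -- whose analyticity is available.
  set μ : Measure ℝ := volume.withDensity fun x => ENNReal.ofReal (temperedPower H lam x)
  have hm : Measurable fun x => ENNReal.ofReal (temperedPower H lam x) :=
    (measurable_temperedPower H lam).ennreal_ofReal
  have h1 (z : ℂ) : complexMGF id μ z =
      ∫ x : ℝ, (temperedPower H lam x : ℂ) * Complex.exp (z * x) := by
    rw [complexMGF, integral_withDensity_eq_integral_toReal_smul hm (by simp)]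
    refine integral_congr_ae (Eventually.of_forall fun x => ?_)
    simp [ENNReal.toReal_ofReal (temperedPower_nonneg H lam x)]
  have h2 : Set.Iio lam ⊆ integrableExpSet id μ := by
    intro t ht
    rw [integrableExpSet, Set.mem_ofPred_eq,
      integrable_withDensity_iff_integrable_smul' hm (by simp)]
    refine (integrable_temperedPower (lam := lam - t) hH (sub_pos.2 ht)).congr
      (Eventually.of_forall fun x => ?_)
    simp [ENNReal.toReal_ofReal (temperedPower_nonneg H lam x), temperedPower_mul_exp]
  have h3 : {z : ℂ | z.re < lam} ⊆ {z : ℂ | z.re ∈ interior (integrableExpSet id μ)} :=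
    fun z hz => interior_maximal h2 isOpen_Iio hz
  have hU : {z : ℂ | z.re < lam} = Complex.re ⁻¹' Set.Iio lam := rfl
  have hopen : IsOpen {z : ℂ | z.re < lam} := isOpen_Iio.preimage Complex.continuous_re
  have h4 : AnalyticOnNhd ℂ (fun z : ℂ =>
      (1 / (lam - z)) ^ ((H + 1 / 2 : ℝ) : ℂ) * Real.Gamma (H + 1 / 2)) {z | z.re < lam} := by
    refine DifferentiableOn.analyticOnNhd (fun z hz => ?_) hopen
    have hz' : 0 < (lam - z : ℂ).re := by simpa using hz
    have hz0 : (lam - z : ℂ) ≠ 0 := fun h => by simp [h] at hz'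
    refine DifferentiableAt.differentiableWithinAt ?_
    refine DifferentiableAt.mul_const (DifferentiableAt.cpow_const ?_ ?_) _
    · exact (differentiableAt_const _).div ((differentiableAt_const _).sub differentiableAt_id) hz0
    -- The reciprocal of a number with positive real part has positive real part, so the principal
    -- power is not evaluated on its branch cut.
    · rw [one_div]
      left
      rw [Complex.inv_re]
      exact div_pos hz' (Complex.normSq_pos.2 hz0)
  have h5 (t : ℝ) (ht : t < lam) : complexMGF id μ t =
      (1 / (lam - t)) ^ ((H + 1 / 2 : ℝ) : ℂ) * Real.Gamma (H + 1 / 2) := by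
    rw [h1]
    have e : ∀ x : ℝ, (temperedPower H lam x : ℂ) * Complex.exp (t * x) =
        (temperedPower H (lam - t) x : ℝ) := fun x => by
      rw [← temperedPower_mul_exp]; push_cast; rfl
    simp_rw [e]
    rw [integral_complex_ofReal, integral_temperedPower hH (sub_pos.2 ht), Complex.ofReal_mul,
      Complex.ofReal_cpow (by have := sub_pos.2 ht; positivity)]
    push_cast
    rfl
  -- Identity theorem on the half plane: both sides are analytic there and agree at the real points
  -- `t < λ`, which accumulate at `λ - 1`.
  have h6 : Set.EqOn (complexMGF id μ) _ {z | z.re < lam} :=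
    (analyticOnNhd_complexMGF.mono h3).eqOn_of_preconnected_of_frequently_eq h4
      (z₀ := ((lam - 1 : ℝ) : ℂ)) ((convex_Iio lam).linear_preimage
        Complex.reLm |>.isPreconnected) (by simp) (by
      have h7 : Tendsto (fun n : ℕ => ((lam - 1 - 1 / ((n : ℝ) + 1) : ℝ) : ℂ)) atTop
          (𝓝[≠] ((lam - 1 : ℝ) : ℂ)) := by
        refine tendsto_nhdsWithin_iff.2 ⟨?_, Eventually.of_forall fun n => ?_⟩
        · refine (Complex.continuous_ofReal.tendsto _).comp ?_
          simpa using tendsto_one_div_add_atTop_nhds_zero_nat.const_sub (lam - 1)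
        · have : (0 : ℝ) < 1 / ((n : ℝ) + 1) := by positivity
          simp only [Set.mem_compl_iff, Set.mem_singleton_iff, Complex.ofReal_inj]
          linarith
      refine h7.frequently (Eventually.of_forall fun n => ?_).frequently
      have : (0 : ℝ) < 1 / ((n : ℝ) + 1) := by positivity
      exact h5 _ (by linarith))
  rw [← h1]
  exact h6 hz

theorem norm_sq_integral_temperedPower_mul_cexp {H lam : ℝ} (hH : 0 < H + 1 / 2) (hlam : 0 < lam)
    (x : ℝ) : ‖∫ t : ℝ, (temperedPower H lam t : ℂ) * Complex.exp (-(Complex.I * x) * t)‖ ^ 2 =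
      Real.Gamma (H + 1 / 2) ^ 2 * (1 / |lam ^ 2 + x ^ 2| ^ (H + 1 / 2)) := by
  rw [integral_temperedPower_mul_cexp hH (by simpa using hlam), norm_mul, Complex.norm_cpow_real,
    mul_pow, mul_comm]
  have e1 : ‖((Real.Gamma (H + 1 / 2) : ℝ) : ℂ)‖ ^ 2 = Real.Gamma (H + 1 / 2) ^ 2 := by
    rw [Complex.norm_real, Real.norm_eq_abs, sq_abs]
  have e2 : ‖(lam - -(Complex.I * x) : ℂ)‖ ^ 2 = |lam ^ 2 + x ^ 2| := by
    rw [Complex.sq_norm, Complex.normSq_apply, abs_of_nonneg (by positivity)]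
    simp
    ring
  rw [e1, norm_div, norm_one, ← e2, one_div, one_div, Real.inv_rpow (norm_nonneg _), inv_pow,
    ← Real.rpow_mul_natCast (norm_nonneg _), ← Real.rpow_natCast_mul (norm_nonneg _)]
  congr 3
  ring_nf

theorem abs_sq_add_sq {lam : ℝ} (x : ℝ) : |lam ^ 2 + x ^ 2| = lam ^ 2 + x ^ 2 :=
  abs_of_nonneg (by positivity)

theorem continuous_spectralDensity {lam : ℝ} (hlam : 0 < lam) (s : ℝ) :
    Continuous fun x : ℝ => 1 / |lam ^ 2 + x ^ 2| ^ s := by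
  refine continuous_const.div (Continuous.rpow_const (by fun_prop) fun x => Or.inl ?_) fun x => ?_
  · rw [abs_sq_add_sq]; positivity
  · rw [abs_sq_add_sq]; positivity

theorem spectralDensity_le {lam s a b K : ℝ} (hs : 0 < s) (hb : 0 < b) (hK : 0 ≤ K)
    (hlam : 0 < lam) (h : b ≤ K * (lam ^ 2 + a ^ 2)) :
    1 / |lam ^ 2 + a ^ 2| ^ s ≤ K ^ s * (1 / b ^ s) := by
  have h0 : 0 < lam ^ 2 + a ^ 2 := by positivity
  rw [abs_sq_add_sq, mul_one_div, div_le_div_iff₀ (by positivity) (by positivity), one_mul,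
    ← Real.mul_rpow hK h0.le]
  exact Real.rpow_le_rpow hb.le h hs.le

theorem integrable_spectralDensity {lam s : ℝ} (hlam : 0 < lam) (hs : 1 / 2 < s) :
    Integrable fun x : ℝ => 1 / |lam ^ 2 + x ^ 2| ^ s := by
  have h := (integrable_rpow_neg_one_add_norm_sq (E := ℝ) (μ := volume) (r := 2 * s)
    (by simp; linarith)).const_mul ((1 + 1 / lam ^ 2) ^ s)
  refine h.mono' (continuous_spectralDensity hlam s).aestronglyMeasurable
    (Eventually.of_forall fun x => ?_)
  rw [Real.norm_of_nonneg (by positivity)]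
  refine (spectralDensity_le (b := 1 + x ^ 2) (K := 1 + 1 / lam ^ 2) (by linarith) (by positivity)
    (by positivity) hlam ?_).trans (le_of_eq ?_)
  · have : (1 + 1 / lam ^ 2) * (lam ^ 2 + x ^ 2) = 1 + x ^ 2 + lam ^ 2 + x ^ 2 / lam ^ 2 := by
      field_simp; ring
    rw [this]
    have : 0 ≤ lam ^ 2 + x ^ 2 / lam ^ 2 := by positivity
    linarith
  · rw [Real.norm_eq_abs, sq_abs, one_div (_ ^ s), ← Real.rpow_neg (by positivity)]
    congr 2
    ring

/-- A summable majorant, uniform for `|x| ≤ R`. The shift by `1/2` keeps the denominator nonzero at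
`l = 0`; the constant comes from `4 l² ≤ (2πl)² ≤ 2 (x + 2πl)² + 2 x²`, the `λ^{-2}` term absorbing
the part that depends on `R`. -/
theorem spectralDensity_add_le {lam s R x : ℝ} (hlam : 0 < lam) (hs : 0 < s) (hx : |x| ≤ R)
    (l : ℤ) : 1 / |lam ^ 2 + (x + 2 * Real.pi * l) ^ 2| ^ s ≤
      (2 + (1 + 2 * R ^ 2) / lam ^ 2) ^ s * (1 / |(l : ℝ) + 1 / 2| ^ (2 * s)) := by
  have h0 : (l : ℝ) + 1 / 2 ≠ 0 := by
    intro h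
    have : ((2 * l + 1 : ℤ) : ℝ) = 0 := by push_cast; linarith
    have : 2 * l + 1 = 0 := by exact_mod_cast this
    omega
  have e : |(l : ℝ) + 1 / 2| ^ (2 * s) = (((l : ℝ) + 1 / 2) ^ 2) ^ s := by
    rw [← sq_abs, ← Real.rpow_natCast_mul (abs_nonneg _)]
    norm_num
  rw [e]
  refine spectralDensity_le hs (by positivity) (by positivity) hlam ?_
  have hxR : x ^ 2 ≤ R ^ 2 := by
    rw [← sq_abs x]; exact pow_le_pow_left₀ (abs_nonneg x) hx 2
  set y := x + 2 * Real.pi * l with hy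
  have h1 : ((l : ℝ) + 1 / 2) ^ 2 ≤ 2 * (l : ℝ) ^ 2 + 1 / 2 := by
    nlinarith [sq_nonneg ((l : ℝ) - 1 / 2)]
  have h2 : (2 * Real.pi * l) ^ 2 ≤ 2 * y ^ 2 + 2 * x ^ 2 := by
    have : 2 * Real.pi * l = y - x := by rw [hy]; ring
    rw [this]; nlinarith [sq_nonneg (y + x)]
  have h3 : (4 : ℝ) * (l : ℝ) ^ 2 ≤ (2 * Real.pi * l) ^ 2 := by
    have := Real.pi_gt_three
    rw [mul_pow]
    gcongr
    nlinarith
  have h4 : (2 + (1 + 2 * R ^ 2) / lam ^ 2) * (lam ^ 2 + y ^ 2) =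
      2 * lam ^ 2 + 2 * y ^ 2 + 1 + 2 * R ^ 2 + (1 + 2 * R ^ 2) * y ^ 2 / lam ^ 2 := by
    field_simp; ring
  rw [h4]
  have h5 : 0 ≤ (1 + 2 * R ^ 2) * y ^ 2 / lam ^ 2 := by positivity
  nlinarith

theorem summable_bound {s : ℝ} (hs : 1 / 2 < s) (C : ℝ) :
    Summable fun l : ℤ => C * (1 / |(l : ℝ) + 1 / 2| ^ (2 * s)) :=
  ((Real.summable_one_div_int_add_rpow (1 / 2) (2 * s)).2 (by linarith)).mul_left _

theorem summable_spectralDensity {lam s : ℝ} (hlam : 0 < lam) (hs : 1 / 2 < s) (x : ℝ) :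
    Summable fun l : ℤ => 1 / |lam ^ 2 + (x + 2 * Real.pi * l) ^ 2| ^ s :=
  Summable.of_nonneg_of_le (fun l => by positivity)
    (fun l => spectralDensity_add_le hlam (by linarith) le_rfl l) (summable_bound hs _)

/-- The periodized spectral density. -/
def periodizedDensity (lam s x : ℝ) : ℝ :=
  ∑' l : ℤ, 1 / |lam ^ 2 + (x + 2 * Real.pi * l) ^ 2| ^ s

theorem continuous_periodizedDensity {lam s : ℝ} (hlam : 0 < lam) (hs : 1 / 2 < s) :
    Continuous (periodizedDensity lam s) := by
  rw [continuous_iff_continuousAt]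
  intro x
  have h : ContinuousOn (periodizedDensity lam s) (Metric.ball 0 (|x| + 1)) := by
    refine continuousOn_tsum (fun l => ?_)
      (summable_bound hs ((2 + (1 + 2 * (|x| + 1) ^ 2) / lam ^ 2) ^ s)) fun l y hy => ?_
    · exact ((continuous_spectralDensity hlam s).comp (by fun_prop)).continuousOn
    · rw [Real.norm_of_nonneg (by positivity)]
      rw [mem_ball_zero_iff, Real.norm_eq_abs] at hy
      exact spectralDensity_add_le hlam (by linarith) hy.le l
  exact h.continuousAt (Metric.isOpen_ball.mem_nhds (by simp))

theorem periodic_periodizedDensity (lam s : ℝ) :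
    Function.Periodic (periodizedDensity lam s) (2 * Real.pi) := by
  intro x
  unfold periodizedDensity
  rw [← (Equiv.addRight (1 : ℤ)).tsum_eq
    fun l : ℤ => 1 / |lam ^ 2 + (x + 2 * Real.pi * l) ^ 2| ^ s]
  congr 1
  ext l
  simp only [Equiv.coe_addRight]
  push_cast
  ring_nf

end SpectralDensity

/-! ### Fourier representation of the autocorrelation and its sampling at the integers. -/

section Autocorrelation

open scoped FourierTransform Convolution ComplexConjugate

variable {H lam : ℝ}

theorem fourier_temperedPower (H lam ξ : ℝ) :
    𝓕 (fun x => (temperedPower H lam x : ℂ)) ξ = ∫ t : ℝ, (temperedPower H lam t : ℂ) *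
      Complex.exp (-(Complex.I * ((2 * Real.pi * ξ : ℝ) : ℂ)) * t) := by
  rw [Real.fourier_real_eq_integral_exp_smul]
  refine integral_congr_ae (Eventually.of_forall fun x => ?_)
  simp only [smul_eq_mul]
  rw [mul_comm]
  congr 2
  push_cast
  ring

theorem fourier_temperedPower_neg (H lam ξ : ℝ) :
    𝓕 (fun x => (temperedPower H lam (-x) : ℂ)) ξ =
      conj (𝓕 (fun x => (temperedPower H lam x : ℂ)) ξ) := by
  rw [fourier_temperedPower, Real.fourier_real_eq_integral_exp_smul, ← integral_conj,
    ← integral_neg_eq_self]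
  refine integral_congr_ae (Eventually.of_forall fun x => ?_)
  simp only [smul_eq_mul, neg_neg, map_mul, Complex.conj_ofReal, ← Complex.exp_conj, map_neg,
    Complex.conj_I]
  rw [mul_comm]
  congr 2
  push_cast
  ring

/-- Fourier representation of the autocorrelation of the tempered power function. -/
theorem integral_temperedPower_mul_comp_add (hH : 0 < H) (hlam : 0 < lam) (t : ℝ) :
    ((∫ x, temperedPower H lam x * temperedPower H lam (x + t) : ℝ) : ℂ) =
      ∫ ξ : ℝ, Complex.exp (Complex.I * (2 * Real.pi * ξ : ℝ) * t) *
        ((Real.Gamma (H + 1 / 2) ^ 2 *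
          (1 / |lam ^ 2 + (2 * Real.pi * ξ) ^ 2| ^ (H + 1 / 2)) : ℝ) : ℂ) := by
  set ρ : ℝ → ℂ := fun t =>
    ((∫ x, temperedPower H lam x * temperedPower H lam (x + t) : ℝ) : ℂ) with hρ
  have hp : Integrable (fun x => (temperedPower H lam x : ℂ)) :=
    (integrable_temperedPower (by linarith) hlam).ofReal
  have hp' : Integrable (fun x => (temperedPower H lam (-x) : ℂ)) := hp.comp_neg
  -- The autocorrelation is the convolution of the function with its reflection, so its Fourier
  -- transform is the squared modulus.
  have hc : (fun x => (temperedPower H lam (-x) : ℂ)) ⋆[ContinuousLinearMap.mul ℂ ℂ]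
      (fun x => (temperedPower H lam x : ℂ)) = ρ := by
    ext t
    rw [convolution_def, hρ]
    simp only
    rw [← integral_complex_ofReal, ← integral_neg_eq_self]
    refine integral_congr_ae (Eventually.of_forall fun x => ?_)
    simp [add_comm]
  -- Pointwise Fourier inversion needs continuity; this comes from square integrability, so the
  -- blow-up of the tempered power at `0` for `H < 1/2` does no harm.
  have hcont : Continuous ρ := Complex.continuous_ofReal.comp
    (continuous_integral_mul_comp_add (memLp_temperedPower hH hlam))
  have hint : Integrable ρ := by
    rw [← hc]
    exact hp'.integrable_convolution _ hp
  have hF (ξ : ℝ) : 𝓕 ρ ξ = ((Real.Gamma (H + 1 / 2) ^ 2 *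
      (1 / |lam ^ 2 + (2 * Real.pi * ξ) ^ 2| ^ (H + 1 / 2)) : ℝ) : ℂ) := by
    rw [← hc, Real.fourier_mul_convolution_eq hp' hp, fourier_temperedPower_neg, mul_comm,
      Complex.mul_conj, Complex.normSq_eq_norm_sq, fourier_temperedPower,
      norm_sq_integral_temperedPower_mul_cexp (by linarith) hlam]
  have hFi : Integrable (𝓕 ρ) := by
    have h1 := (integrable_spectralDensity (s := H + 1 / 2) hlam (by linarith)).const_mul
      (Real.Gamma (H + 1 / 2) ^ 2)
    exact (h1.comp_mul_left' (R := 2 * Real.pi) (by positivity)).ofReal.congr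
      (Eventually.of_forall fun ξ => (hF ξ).symm)
  have h := congrFun (hcont.fourierInv_fourier_eq hint hFi) t
  change ρ t = _
  rw [← h, Real.fourierInv_eq']
  refine integral_congr_ae (Eventually.of_forall fun ξ => ?_)
  simp only [hF, smul_eq_mul]
  congr 2
  simp
  ring

/-- Folding an integral over the line into an integral over a period. -/
theorem integral_eq_intervalIntegral_tsum {G : ℝ → ℂ} (hGc : Continuous G) (hGi : Integrable G)
    {u : ℤ → ℝ} (hu : Summable u)
    (h : ∀ (n : ℤ) (ξ : ℝ), |ξ| ≤ 1 / 2 → ‖G (ξ + n)‖ ≤ u n) :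
    ∫ ξ, G ξ = ∫ ξ in (-(1 / 2) : ℝ)..(1 / 2), ∑' n : ℤ, G (ξ + n) := by
  have h1 := hGi.hasSum_intervalIntegral (-(1 / 2))
  have e1 (n : ℤ) : ∫ ξ in (-(1 / 2) + n : ℝ)..(-(1 / 2) + n + 1 : ℝ), G ξ =
      ∫ ξ in (-(1 / 2) : ℝ)..(1 / 2 : ℝ), G (ξ + n) := by
    rw [intervalIntegral.integral_comp_add_right]
    congr 1
    ring
  simp_rw [e1] at h1
  rw [← h1.tsum_eq]
  have h3 : Summable fun n : ℤ => ‖ContinuousMap.restrict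
      (⟨Set.uIcc (-(1 / 2) : ℝ) (1 / 2), isCompact_uIcc⟩ : TopologicalSpace.Compacts ℝ)
      (⟨fun ξ => G (ξ + n), hGc.comp (by fun_prop)⟩ : C(ℝ, ℂ))‖ := by
    refine Summable.of_nonneg_of_le (fun n => norm_nonneg _) (fun n => ?_) hu
    rw [ContinuousMap.norm_le _ ((norm_nonneg _).trans (h n 0 (by norm_num)))]
    rintro ⟨ξ, hξ⟩
    have h4 : ξ ∈ Set.uIcc (-(1 / 2) : ℝ) (1 / 2) := hξ
    rw [Set.uIcc_of_le (by norm_num), Set.mem_Icc, ← abs_le] at h4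
    exact h n ξ h4
  exact intervalIntegral.tsum_intervalIntegral_eq_of_summable_norm h3

/-- The autocorrelation at the integers is given by the periodized spectral density. -/
theorem integral_temperedPower_mul_comp_add_int (hH : 0 < H) (hlam : 0 < lam) (m : ℤ) :
    ((∫ x, temperedPower H lam x * temperedPower H lam (x + m) : ℝ) : ℂ) =
      ((Real.Gamma (H + 1 / 2) ^ 2 / (2 * Real.pi) : ℝ) : ℂ) *
        ∫ x in (-Real.pi)..Real.pi, Complex.exp (Complex.I * x * m) *
          periodizedDensity lam (H + 1 / 2) x := by
  set s := H + 1 / 2 with hs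
  have hs' : 1 / 2 < s := by linarith
  set G : ℝ → ℂ := fun ξ => Complex.exp (Complex.I * (2 * Real.pi * ξ : ℝ) * m) *
    ((Real.Gamma s ^ 2 * (1 / |lam ^ 2 + (2 * Real.pi * ξ) ^ 2| ^ s) : ℝ) : ℂ) with hG
  have hGc : Continuous G := by
    refine Continuous.mul (by fun_prop) (Complex.continuous_ofReal.comp ?_)
    exact continuous_const.mul ((continuous_spectralDensity hlam s).comp (by fun_prop))
  have hGn (ξ : ℝ) : ‖G ξ‖ = Real.Gamma s ^ 2 * (1 / |lam ^ 2 + (2 * Real.pi * ξ) ^ 2| ^ s) := by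
    rw [hG]
    simp only
    rw [norm_mul, Complex.norm_real, Real.norm_of_nonneg (by positivity)]
    have : Complex.I * (2 * Real.pi * ξ : ℝ) * m = ((2 * Real.pi * ξ * m : ℝ) : ℂ) * Complex.I := by
      push_cast; ring
    rw [this, Complex.norm_exp_ofReal_mul_I, one_mul]
  have hGi : Integrable G := by
    have h1 := ((integrable_spectralDensity (s := s) hlam hs').const_mul
      (Real.Gamma s ^ 2)).comp_mul_left' (R := 2 * Real.pi) (by positivity)
    exact h1.mono' hGc.aestronglyMeasurable (Eventually.of_forall fun ξ => (hGn ξ).le)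
  rw [integral_temperedPower_mul_comp_add hH hlam]
  -- Here `m` being an integer matters: the exponential has period one in `ξ`, so folding periodizes
  -- only the density.
  have e2 (n : ℤ) (ξ : ℝ) : G (ξ + n) = Complex.exp (Complex.I * (2 * Real.pi * ξ : ℝ) * m) *
      ((Real.Gamma s ^ 2 * (1 / |lam ^ 2 + (2 * Real.pi * ξ + 2 * Real.pi * n) ^ 2| ^ s) : ℝ) : ℂ)
      := by
    rw [hG]
    simp only [mul_add]
    congr 1
    rw [← Complex.exp_periodic.int_mul (n * m) (Complex.I * (2 * Real.pi * ξ : ℝ) * m)]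
    congr 1
    push_cast
    ring
  have h4 : ∫ ξ, G ξ = ∫ ξ in (-(1 / 2) : ℝ)..(1 / 2), ∑' n : ℤ, G (ξ + n) := by
    refine integral_eq_intervalIntegral_tsum hGc hGi
      (summable_bound hs' (Real.Gamma s ^ 2 * (2 + (1 + 2 * Real.pi ^ 2) / lam ^ 2) ^ s))
      fun n ξ hξ => ?_
    have hx : |2 * Real.pi * ξ| ≤ Real.pi := by
      rw [abs_mul, abs_of_pos (by positivity)]
      nlinarith [Real.pi_pos]
    have hb := mul_le_mul_of_nonneg_left
      (spectralDensity_add_le (s := s) hlam (by linarith) hx n) (sq_nonneg (Real.Gamma s))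
    rw [hGn, mul_add (2 * Real.pi)]
    exact hb.trans_eq (mul_assoc _ _ _).symm
  change ∫ ξ, G ξ = _
  rw [h4]
  simp_rw [e2, tsum_mul_left]
  have e3 (ξ : ℝ) : ∑' n : ℤ, ((Real.Gamma s ^ 2 *
      (1 / |lam ^ 2 + (2 * Real.pi * ξ + 2 * Real.pi * n) ^ 2| ^ s) : ℝ) : ℂ) =
      ((Real.Gamma s ^ 2 : ℝ) : ℂ) * (periodizedDensity lam s (2 * Real.pi * ξ) : ℝ) := by
    rw [← Complex.ofReal_tsum, tsum_mul_left, ← Complex.ofReal_mul]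
    rfl
  simp_rw [e3]
  have h5 := intervalIntegral.integral_comp_mul_left (a := -(1 / 2)) (b := 1 / 2)
    (fun x : ℝ => Complex.exp (Complex.I * x * m) *
      (((Real.Gamma s ^ 2 : ℝ) : ℂ) * (periodizedDensity lam s x : ℝ)))
    (c := 2 * Real.pi) (by positivity)
  rw [h5, show 2 * Real.pi * -(1 / 2) = -Real.pi by ring, show 2 * Real.pi * (1 / 2) = Real.pi by
    ring]
  have e4 (x : ℝ) : Complex.exp (Complex.I * x * m) *
      (((Real.Gamma s ^ 2 : ℝ) : ℂ) * (periodizedDensity lam s x : ℝ)) =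
      ((Real.Gamma s ^ 2 : ℝ) : ℂ) * (Complex.exp (Complex.I * x * m) *
        (periodizedDensity lam s x : ℝ)) := by ring
  simp_rw [e4]
  rw [intervalIntegral.integral_const_mul, Complex.real_smul, ← mul_assoc, ← Complex.ofReal_mul]
  congr 2
  ring

end Autocorrelation

/-! ### Covariance of the wavelet coefficients. -/

section Covariance

open scoped ComplexConjugate

variable {H lam : ℝ}

theorem integral_temperedPower_sub_mul_sub (H lam a b : ℝ) :
    ∫ u, temperedPower H lam (a - u) * temperedPower H lam (b - u) =
      ∫ x, temperedPower H lam x * temperedPower H lam (x + (b - a)) := by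
  rw [← integral_sub_left_eq_self _ volume a]
  refine integral_congr_ae (Eventually.of_forall fun x => ?_)
  simp only [sub_sub_cancel]
  ring_nf

/-- Apart from the stationary term, every summand depends on at most one of `a` and `b`, the form in
which a zero-sum filter can remove it. -/
theorem integral_tfbmKernel_mul (hH : 0 < H) (hlam : 0 < lam) (a b : ℝ) :
    ∫ u, (temperedPower H lam (a - u) - temperedPower H lam (-u)) *
        (temperedPower H lam (b - u) - temperedPower H lam (-u)) =
      (∫ x, temperedPower H lam x * temperedPower H lam (x + (b - a))) -
      (∫ x, temperedPower H lam x * temperedPower H lam (x + -a)) -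
      (∫ x, temperedPower H lam x * temperedPower H lam (x + b)) +
      ∫ x, temperedPower H lam x * temperedPower H lam x := by
  have hi (a b : ℝ) : Integrable fun u =>
      temperedPower H lam (a - u) * temperedPower H lam (b - u) :=
    ((memLp_temperedPower hH hlam).comp_measurePreserving
      (Measure.measurePreserving_sub_left volume a)).integrable_mul
      ((memLp_temperedPower hH hlam).comp_measurePreserving
        (Measure.measurePreserving_sub_left volume b))
  have e := integral_temperedPower_sub_mul_sub H lam
  have e0 := e 0 b
  have e1 := e a 0
  have e2 := e 0 0
  have i0 := hi 0 b
  have i1 := hi a 0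
  have i2 := hi 0 0
  simp only [zero_sub, sub_zero, add_zero] at e0 e1 e2 i0 i1 i2
  have i3 : Integrable fun u => temperedPower H lam (a - u) * temperedPower H lam (b - u) -
      temperedPower H lam (a - u) * temperedPower H lam (-u) := (hi a b).sub i1
  have i4 : Integrable fun u => temperedPower H lam (a - u) * temperedPower H lam (b - u) -
      temperedPower H lam (a - u) * temperedPower H lam (-u) -
      temperedPower H lam (-u) * temperedPower H lam (b - u) := i3.sub i0
  rw [← e a b, ← e1, ← e0, ← e2, ← integral_sub (hi a b) i1, ← integral_sub i3 i0,
    ← integral_add i4 i2]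
  refine integral_congr_ae (Eventually.of_forall fun u => ?_)
  ring

variable {Ω : Type*} {B : ℝ → Ω → ℝ} {φ ψ : ℝ → ℝ} {N : ℕ}

theorem waveletCoeff_eq_sum (hW : IsAdmissibleWavelet φ ψ N) {j : ℕ} (hj : 1 ≤ j) {s : Finset ℤ}
    (hs : ∀ l ∉ s, filterCoeff φ ψ j l = 0) (k : ℤ) (ω : Ω) :
    waveletCoeff φ ψ B j k ω =
      ∑ l ∈ s, filterCoeff φ ψ j l * B ((2 ^ j * k - l : ℤ) : ℝ) ω := by
  rw [waveletCoeff, detailCoeff_eq_tsum hW _ hj, ← (Equiv.subLeft (2 ^ j * k : ℤ)).tsum_eq]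
  simp only [Equiv.subLeft_apply, sub_sub_cancel]
  exact tsum_eq_sum fun l hl => by rw [hs l hl, zero_mul]

variable [MeasurableSpace Ω] {P : Measure Ω} {σ : ℝ} {M : Set ℝ → Ω → ℝ}

theorem memLp_waveletCoeff (hB : IsTemperedFBM P H lam M B)
    (hW : IsAdmissibleWavelet φ ψ N) {j : ℕ} (hj : 1 ≤ j) (k : ℤ) :
    MemLp (waveletCoeff φ ψ B j k) 2 P := by
  have hs : ∀ l ∉ (finite_support_filterCoeff hW.compact_psi hW.compact_phi j).toFinset,
      filterCoeff φ ψ j l = 0 := fun l hl => by simpa using hl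
  simp_rw [funext fun ω => waveletCoeff_eq_sum (B := B) hW hj hs k ω]
  exact memLp_finsetSum _ fun l _ => (hB _).2.1.const_mul _

theorem integral_waveletCoeff [IsProbabilityMeasure P] (hM : IsGaussianRandomMeasure P σ M)
    (hB : IsTemperedFBM P H lam M B) (hW : IsAdmissibleWavelet φ ψ N) {j : ℕ} (hj : 1 ≤ j)
    (k : ℤ) : ∫ ω, waveletCoeff φ ψ B j k ω ∂P = 0 := by
  have hs : ∀ l ∉ (finite_support_filterCoeff hW.compact_psi hW.compact_phi j).toFinset,
      filterCoeff φ ψ j l = 0 := fun l hl => by simpa using hl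
  simp_rw [waveletCoeff_eq_sum (B := B) hW hj hs k]
  rw [integral_finsetSum _ fun l _ => ((hB _).2.1.integrable one_le_two).const_mul _]
  refine Finset.sum_eq_zero fun l _ => ?_
  rw [integral_const_mul, (hB _).integral_eq_zero hM, mul_zero]

/-- The covariance of the wavelet coefficients in terms of the autocorrelation of the tempered
power function. The non-stationary part is removed by the vanishing moment. -/
theorem integral_waveletCoeff_mul (hH : 0 < H) (hlam : 0 < lam)
    (hM : IsGaussianRandomMeasure P σ M) (hB : IsTemperedFBM P H lam M B)
    (hW : IsAdmissibleWavelet φ ψ N) {j j' : ℕ} (hj : 1 ≤ j) (hj' : 1 ≤ j') {s s' : Finset ℤ}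
    (hs : ∀ l ∉ s, filterCoeff φ ψ j l = 0) (hs' : ∀ l ∉ s', filterCoeff φ ψ j' l = 0)
    (k k' : ℤ) :
    ∫ ω, waveletCoeff φ ψ B j k ω * waveletCoeff φ ψ B j' k' ω ∂P =
      σ ^ 2 * ∑ l ∈ s, ∑ l' ∈ s', filterCoeff φ ψ j l * filterCoeff φ ψ j' l' *
        ∫ x, temperedPower H lam x * temperedPower H lam
          (x + ((2 ^ j' * k' - l' - (2 ^ j * k - l) : ℤ) : ℝ)) := by
  have h0 : ∑ l ∈ s, filterCoeff φ ψ j l = 0 := by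
    rw [← tsum_eq_sum (L := SummationFilter.unconditional ℤ) hs, tsum_filterCoeff_eq_zero hW]
  have h0' : ∑ l ∈ s', filterCoeff φ ψ j' l = 0 := by
    rw [← tsum_eq_sum (L := SummationFilter.unconditional ℤ) hs', tsum_filterCoeff_eq_zero hW]
  set ρ : ℝ → ℝ := fun t => ∫ x, temperedPower H lam x * temperedPower H lam (x + t) with hρ
  have hcov (l l' : ℤ) : ∫ ω, B l ω * B l' ω ∂P =
      σ ^ 2 * (ρ ((l' - l : ℤ) : ℝ) - ρ (-l) - ρ l' + ρ 0) := by
    rw [(hB l).integral_mul hM (hB l'), integral_tfbmKernel_mul hH hlam]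
    simp [hρ]
  simp_rw [waveletCoeff_eq_sum (B := B) hW hj hs k, waveletCoeff_eq_sum (B := B) hW hj' hs' k',
    Finset.sum_mul_sum]
  have hi (l l' : ℤ) : Integrable (fun ω =>
      filterCoeff φ ψ j l * B ((2 ^ j * k - l : ℤ) : ℝ) ω *
        (filterCoeff φ ψ j' l' * B ((2 ^ j' * k' - l' : ℤ) : ℝ) ω)) P :=
    ((hB _).2.1.const_mul _).integrable_mul ((hB _).2.1.const_mul _)
  rw [integral_finsetSum _ fun l _ => integrable_finsetSum _ fun l' _ => hi l l']
  simp_rw [integral_finsetSum _ fun l' _ => hi _ l']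
  -- Each subtracted term involves one of the two indices only through its filter coefficient, so
  -- summing over that index gives zero; the constant `ρ 0` is grouped with the first of them.
  have e (l l' : ℤ) : ∫ ω, filterCoeff φ ψ j l * B ((2 ^ j * k - l : ℤ) : ℝ) ω *
        (filterCoeff φ ψ j' l' * B ((2 ^ j' * k' - l' : ℤ) : ℝ) ω) ∂P =
      σ ^ 2 * (filterCoeff φ ψ j l * filterCoeff φ ψ j' l' *
          ρ ((2 ^ j' * k' - l' - (2 ^ j * k - l) : ℤ) : ℝ)) -
        filterCoeff φ ψ j' l' *
          (filterCoeff φ ψ j l * (σ ^ 2 * (ρ (-(2 ^ j * k - l : ℤ)) - ρ 0))) -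
        filterCoeff φ ψ j l *
          (filterCoeff φ ψ j' l' * (σ ^ 2 * ρ (2 ^ j' * k' - l' : ℤ))) := by
    have e1 : ∀ ω, filterCoeff φ ψ j l * B ((2 ^ j * k - l : ℤ) : ℝ) ω *
        (filterCoeff φ ψ j' l' * B ((2 ^ j' * k' - l' : ℤ) : ℝ) ω) =
        filterCoeff φ ψ j l * filterCoeff φ ψ j' l' *
          (B ((2 ^ j * k - l : ℤ) : ℝ) ω * B ((2 ^ j' * k' - l' : ℤ) : ℝ) ω) := fun ω => by ring
    simp_rw [e1]
    rw [integral_const_mul, hcov]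
    ring
  simp_rw [e, Finset.sum_sub_distrib, ← Finset.sum_mul, ← Finset.mul_sum]
  rw [h0', ← Finset.sum_mul, h0]
  simp only [zero_mul, sub_zero, hρ]

theorem filterTransform_eq_sum {j : ℕ} {s : Finset ℤ} (hs : ∀ l ∉ s, filterCoeff φ ψ j l = 0)
    (x : ℝ) : filterTransform φ ψ j x =
      ∑ l ∈ s, (filterCoeff φ ψ j l : ℂ) * Complex.exp (Complex.I * x * l) :=
  tsum_eq_sum fun l hl => by rw [hs l hl, Complex.ofReal_zero, zero_mul]

theorem filterTransform_mul_conj {j j' : ℕ} {s s' : Finset ℤ}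
    (hs : ∀ l ∉ s, filterCoeff φ ψ j l = 0) (hs' : ∀ l ∉ s', filterCoeff φ ψ j' l = 0) (x : ℝ) :
    filterTransform φ ψ j x * conj (filterTransform φ ψ j' x) =
      ∑ l ∈ s, ∑ l' ∈ s', (filterCoeff φ ψ j l * filterCoeff φ ψ j' l' : ℝ) *
        Complex.exp (Complex.I * x * ((l - l' : ℤ) : ℂ)) := by
  rw [filterTransform_eq_sum hs, filterTransform_eq_sum hs', map_sum, Finset.sum_mul_sum]
  refine Finset.sum_congr rfl fun l _ => Finset.sum_congr rfl fun l' _ => ?_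
  simp only [map_mul, Complex.conj_ofReal, ← Complex.exp_conj, Complex.conj_I, map_intCast]
  rw [mul_mul_mul_comm, ← Complex.exp_add]
  push_cast
  ring_nf

theorem continuous_filterTransform (hW : IsAdmissibleWavelet φ ψ N) (j : ℕ) :
    Continuous (filterTransform φ ψ j) := by
  have hs : ∀ l ∉ (finite_support_filterCoeff hW.compact_psi hW.compact_phi j).toFinset,
      filterCoeff φ ψ j l = 0 := fun l hl => by simpa using hl
  rw [funext (filterTransform_eq_sum hs)]
  fun_prop

theorem tsum_div_spectralDensity (lam s x : ℝ) (z : ℂ) :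
    ∑' l : ℤ, z / ((|lam ^ 2 + (x + 2 * Real.pi * l) ^ 2| ^ s : ℝ) : ℂ) =
      z * periodizedDensity lam s x := by
  rw [periodizedDensity, Complex.ofReal_tsum, ← tsum_mul_left]
  congr 1
  ext l
  push_cast
  ring

theorem tsum_div_spectralDensity_real (lam s x z : ℝ) :
    ∑' l : ℤ, z / |lam ^ 2 + (x + 2 * Real.pi * l) ^ 2| ^ s = z * periodizedDensity lam s x := by
  rw [periodizedDensity, ← tsum_mul_left]
  congr 1
  ext l
  ring

/-- Spectral representation of the covariance of the wavelet coefficients. -/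
theorem integral_waveletCoeff_mul_eq (hH : 0 < H) (hlam : 0 < lam)
    (hM : IsGaussianRandomMeasure P σ M) (hB : IsTemperedFBM P H lam M B)
    (hW : IsAdmissibleWavelet φ ψ N) {j j' : ℕ} (hj : 1 ≤ j) (hj' : 1 ≤ j') (k k' : ℤ) :
    ((∫ ω, waveletCoeff φ ψ B j k ω * waveletCoeff φ ψ B j' k' ω ∂P : ℝ) : ℂ) =
      ((σ ^ 2 * Real.Gamma (H + 1 / 2) ^ 2 / (2 * Real.pi) : ℝ) : ℂ) *
        ∫ x in (-Real.pi)..Real.pi,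
          Complex.exp (-(Complex.I * x * ((2 : ℂ) ^ j * k - (2 : ℂ) ^ j' * k'))) *
            (filterTransform φ ψ j x * conj (filterTransform φ ψ j' x) *
              periodizedDensity lam (H + 1 / 2) x) := by
  have hs : ∀ l ∉ (finite_support_filterCoeff hW.compact_psi hW.compact_phi j).toFinset,
      filterCoeff φ ψ j l = 0 := fun l hl => by simpa using hl
  have hs' : ∀ l ∉ (finite_support_filterCoeff hW.compact_psi hW.compact_phi j').toFinset,
      filterCoeff φ ψ j' l = 0 := fun l hl => by simpa using hl
  set s := (finite_support_filterCoeff hW.compact_psi hW.compact_phi j).toFinset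
  set s' := (finite_support_filterCoeff hW.compact_psi hW.compact_phi j').toFinset
  rw [integral_waveletCoeff_mul hH hlam hM hB hW hj hj' hs hs']
  have hD : Continuous fun x : ℝ => (periodizedDensity lam (H + 1 / 2) x : ℂ) :=
    Complex.continuous_ofReal.comp (continuous_periodizedDensity hlam (by linarith))
  have e (x : ℝ) : Complex.exp (-(Complex.I * x * ((2 : ℂ) ^ j * k - (2 : ℂ) ^ j' * k'))) *
      (filterTransform φ ψ j x * conj (filterTransform φ ψ j' x) *
        periodizedDensity lam (H + 1 / 2) x) =
      ∑ l ∈ s, ∑ l' ∈ s', (filterCoeff φ ψ j l * filterCoeff φ ψ j' l' : ℝ) *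
        (Complex.exp (Complex.I * x * ((2 ^ j' * k' - l' - (2 ^ j * k - l) : ℤ) : ℂ)) *
          periodizedDensity lam (H + 1 / 2) x) := by
    rw [filterTransform_mul_conj hs hs', Finset.sum_mul, Finset.mul_sum]
    refine Finset.sum_congr rfl fun l _ => ?_
    rw [Finset.sum_mul, Finset.mul_sum]
    refine Finset.sum_congr rfl fun l' _ => ?_
    have : Complex.exp (Complex.I * x * ((2 ^ j' * k' - l' - (2 ^ j * k - l) : ℤ) : ℂ)) =
        Complex.exp (-(Complex.I * x * ((2 : ℂ) ^ j * k - (2 : ℂ) ^ j' * k'))) *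
          Complex.exp (Complex.I * x * ((l - l' : ℤ) : ℂ)) := by
      rw [← Complex.exp_add]
      push_cast
      ring_nf
    rw [this]
    ring
  have hi (l l' : ℤ) : IntervalIntegrable (fun x : ℝ =>
      ((filterCoeff φ ψ j l * filterCoeff φ ψ j' l' : ℝ) : ℂ) *
        (Complex.exp (Complex.I * x * ((2 ^ j' * k' - l' - (2 ^ j * k - l) : ℤ) : ℂ)) *
          periodizedDensity lam (H + 1 / 2) x)) volume (-Real.pi) Real.pi :=
    Continuous.intervalIntegrable (by fun_prop) _ _
  simp_rw [e]
  rw [intervalIntegral.integral_finsetSum fun l _ =>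
    Continuous.intervalIntegrable (by fun_prop) _ _]
  simp_rw [intervalIntegral.integral_finsetSum fun l' _ => hi _ l',
    intervalIntegral.integral_const_mul]
  push_cast
  simp_rw [Finset.mul_sum]
  refine Finset.sum_congr rfl fun l _ => Finset.sum_congr rfl fun l' _ => ?_
  have h := integral_temperedPower_mul_comp_add_int hH hlam
    (2 ^ j' * k' - l' - (2 ^ j * k - l))
  push_cast at h
  rw [h]
  ring

end Covariance

/-! ### Concentration of `|𝓗_j|²` at the origin. -/

section CoarseScaleLimit

open scoped ComplexConjugate

variable {H lam : ℝ} {φ ψ : ℝ → ℝ} {N : ℕ}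

theorem integral_cexp_int_mul (n : ℤ) :
    ∫ x in (-Real.pi)..Real.pi, Complex.exp (Complex.I * x * n) =
      if n = 0 then (2 * Real.pi : ℂ) else 0 := by
  split_ifs with hn
  · simp [hn]
    ring
  · have h : Complex.I * n ≠ 0 := mul_ne_zero Complex.I_ne_zero (by exact_mod_cast hn)
    have e (x : ℝ) : Complex.I * x * n = Complex.I * n * x := by ring
    simp_rw [e]
    rw [integral_exp_mul_complex h,
      ← Complex.exp_periodic.int_mul n (Complex.I * n * (-Real.pi : ℝ))]
    have : Complex.I * n * (-Real.pi : ℝ) + n * (2 * Real.pi * Complex.I) =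
        Complex.I * n * (Real.pi : ℝ) := by push_cast; ring
    rw [this, sub_self, zero_div]

/-- The Fourier coefficients of `|𝓗_j|²`. -/
theorem integral_norm_sq_filterTransform_mul_cexp (hW : IsAdmissibleWavelet φ ψ N) {j : ℕ}
    (hj : 1 ≤ j) (m : ℤ) :
    ∫ x in (-Real.pi)..Real.pi, ((‖filterTransform φ ψ j x‖ ^ 2 : ℝ) : ℂ) *
        Complex.exp (Complex.I * x * m) =
      2 * Real.pi * ((∫ t, ψ t * ψ (t + -((2 : ℝ) ^ (-(j : ℤ)) * m)) : ℝ) : ℂ) := by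
  have hs : ∀ l ∉ (finite_support_filterCoeff hW.compact_psi hW.compact_phi j).toFinset,
      filterCoeff φ ψ j l = 0 := fun l hl => by simpa using hl
  set s := (finite_support_filterCoeff hW.compact_psi hW.compact_phi j).toFinset
  have e (x : ℝ) : ((‖filterTransform φ ψ j x‖ ^ 2 : ℝ) : ℂ) * Complex.exp (Complex.I * x * m) =
      ∑ l ∈ s, ∑ l' ∈ s, (filterCoeff φ ψ j l * filterCoeff φ ψ j l' : ℝ) *
        Complex.exp (Complex.I * x * ((l + m - l' : ℤ) : ℂ)) := by
    rw [← Complex.normSq_eq_norm_sq, ← Complex.mul_conj, filterTransform_mul_conj hs hs,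
      Finset.sum_mul]
    refine Finset.sum_congr rfl fun l _ => ?_
    rw [Finset.sum_mul]
    refine Finset.sum_congr rfl fun l' _ => ?_
    rw [mul_assoc, ← Complex.exp_add]
    push_cast
    ring_nf
  simp_rw [e]
  rw [intervalIntegral.integral_finsetSum fun l _ =>
    Continuous.intervalIntegrable (by fun_prop) _ _]
  have e2 (l : ℤ) : ∫ x in (-Real.pi)..Real.pi, ∑ l' ∈ s,
      ((filterCoeff φ ψ j l * filterCoeff φ ψ j l' : ℝ) : ℂ) *
        Complex.exp (Complex.I * x * ((l + m - l' : ℤ) : ℂ)) =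
      2 * Real.pi * ((filterCoeff φ ψ j l * filterCoeff φ ψ j (l + m) : ℝ) : ℂ) := by
    rw [intervalIntegral.integral_finsetSum fun l' _ =>
      Continuous.intervalIntegrable (by fun_prop) _ _]
    simp_rw [intervalIntegral.integral_const_mul, integral_cexp_int_mul]
    -- If `l + m` falls outside `s`, its filter coefficient is zero, so the formula still holds.
    rw [Finset.sum_eq_single (l + m)]
    · simp
      ring
    · intro l' _ h
      rw [if_neg (fun h' => h (by omega)), mul_zero]
    · intro h
      rw [hs _ h]
      simp
  simp_rw [e2]
  rw [← tsum_filterCoeff_mul_filterCoeff hW hj m,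
    tsum_eq_sum (s := s) fun l hl => by rw [hs l hl, zero_mul], Complex.ofReal_sum, Finset.mul_sum]

theorem integral_norm_sq_filterTransform (hW : IsAdmissibleWavelet φ ψ N) {j : ℕ}
    (hj : 1 ≤ j) : ∫ x in (-Real.pi)..Real.pi, ‖filterTransform φ ψ j x‖ ^ 2 = 2 * Real.pi := by
  have h := integral_norm_sq_filterTransform_mul_cexp hW hj 0
  have h2 := hW.integral_sq
  simp only [Int.cast_zero, mul_zero, Complex.exp_zero, mul_one, neg_zero, add_zero, ← sq, h2] at h
  rw [intervalIntegral.integral_ofReal] at h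
  rw [← mul_one (2 * Real.pi)]
  exact_mod_cast h

/-- The probability densities `|𝓗_j|² / 2π` on the circle concentrate at the origin. -/
theorem tendsto_integral_norm_sq_filterTransform_mul (hW : IsAdmissibleWavelet φ ψ N)
    {F : ℝ → ℂ} (hF : Continuous F) (hp : Function.Periodic F (2 * Real.pi)) :
    Tendsto (fun j : ℕ => ∫ x in (-Real.pi)..Real.pi,
      ((‖filterTransform φ ψ j x‖ ^ 2 : ℝ) : ℂ) * F x) atTop (𝓝 (2 * Real.pi * F 0)) := by
  have : Fact (0 < 2 * Real.pi) := ⟨by positivity⟩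
  have hc (j : ℕ) : Continuous (filterTransform φ ψ j) := continuous_filterTransform hW j
  have hFc (G : C(AddCircle (2 * Real.pi), ℂ)) : Continuous fun x : ℝ => G x :=
    G.continuous.comp (AddCircle.continuous_mk' _)
  have hi (j : ℕ) (G : C(AddCircle (2 * Real.pi), ℂ)) : IntervalIntegrable (fun x : ℝ =>
      ((‖filterTransform φ ψ j x‖ ^ 2 : ℝ) : ℂ) * G x) volume (-Real.pi) Real.pi := by
    have := hFc G
    have := hc j
    exact Continuous.intervalIntegrable (by fun_prop) _ _
  -- The test functions for which the limit holds form a subspace. It is closed because all the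
  -- measures have mass `2π`, and it contains the Fourier monomials, so it is everything.
  let K : Submodule ℂ C(AddCircle (2 * Real.pi), ℂ) :=
    { carrier := {G | Tendsto (fun j : ℕ => ∫ x in (-Real.pi)..Real.pi,
        ((‖filterTransform φ ψ j x‖ ^ 2 : ℝ) : ℂ) * G x) atTop (𝓝 (2 * Real.pi * G 0))}
      zero_mem' := by simp
      add_mem' := fun {G G'} hG hG' => by
        have h := Tendsto.add hG hG'
        simp_rw [← intervalIntegral.integral_add (hi _ G) (hi _ G'), ← mul_add] at h
        exact h
      smul_mem' := fun c G hG => by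
        have h := Tendsto.const_mul c hG
        simp_rw [← intervalIntegral.integral_const_mul, mul_left_comm c] at h
        exact h }
  have hK : K.topologicalClosure = K := by
    refine IsClosed.submodule_topologicalClosure_eq (isClosed_of_closure_subset fun G hG => ?_)
    change Tendsto _ _ _
    rw [Metric.tendsto_atTop]
    intro ε hε
    have hπ := Real.pi_pos
    -- The constant makes each of the two replacement errors `2π · dist G G'` smaller than `ε/4`.
    obtain ⟨G', hG', hd⟩ := Metric.mem_closure_iff.1 hG (ε / (8 * Real.pi)) (by positivity)
    obtain ⟨n, hn⟩ := Metric.tendsto_atTop.1 (show Tendsto _ _ _ from hG') (ε / 2) (by positivity)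
    refine ⟨max n 1, fun j hj => ?_⟩
    have h1 := hn j (le_of_max_le_left hj)
    have h2 (y : AddCircle (2 * Real.pi)) : ‖G y - G' y‖ ≤ dist G G' := by
      rw [← dist_eq_norm]
      exact ContinuousMap.dist_apply_le_dist y
    have h3 : ‖(∫ x in (-Real.pi)..Real.pi, ((‖filterTransform φ ψ j x‖ ^ 2 : ℝ) : ℂ) * G x) -
        ∫ x in (-Real.pi)..Real.pi, ((‖filterTransform φ ψ j x‖ ^ 2 : ℝ) : ℂ) * G' x‖ ≤
        2 * Real.pi * dist G G' := by
      have e1 := intervalIntegral.integral_mul_const (μ := volume) (a := -Real.pi) (b := Real.pi)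
        (dist G G') fun x => ‖filterTransform φ ψ j x‖ ^ 2
      rw [integral_norm_sq_filterTransform hW (le_of_max_le_right hj)] at e1
      rw [← intervalIntegral.integral_sub (hi j G) (hi j G')]
      have := hc j
      refine (intervalIntegral.norm_integral_le_of_norm_le (by linarith)
        (Eventually.of_forall fun x _ => ?_)
        (Continuous.intervalIntegrable (by fun_prop) _ _)).trans_eq e1
      rw [← mul_sub, norm_mul, Complex.norm_real, Real.norm_of_nonneg (by positivity)]
      exact mul_le_mul_of_nonneg_left (h2 x) (by positivity)
    have h4 : ‖2 * Real.pi * G' 0 - 2 * Real.pi * G 0‖ ≤ 2 * Real.pi * dist G G' := by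
      rw [← mul_sub, norm_mul]
      have : ‖(2 * Real.pi : ℂ)‖ = 2 * Real.pi := by
        rw [norm_mul, Complex.norm_real, Real.norm_of_nonneg hπ.le]; simp
      rw [this, norm_sub_rev]
      exact mul_le_mul_of_nonneg_left (h2 0) (by positivity)
    have h5 : 2 * Real.pi * dist G G' < ε / 4 := by
      rw [lt_div_iff₀ (by positivity)] at hd
      linarith
    rw [dist_eq_norm] at h1 ⊢
    have h6 := norm_add₃_le (a := (∫ x in (-Real.pi)..Real.pi,
      ((‖filterTransform φ ψ j x‖ ^ 2 : ℝ) : ℂ) * G x) -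
        ∫ x in (-Real.pi)..Real.pi, ((‖filterTransform φ ψ j x‖ ^ 2 : ℝ) : ℂ) * G' x)
      (b := (∫ x in (-Real.pi)..Real.pi, ((‖filterTransform φ ψ j x‖ ^ 2 : ℝ) : ℂ) * G' x) -
        2 * Real.pi * G' 0) (c := 2 * Real.pi * G' 0 - 2 * Real.pi * G 0)
    rw [sub_add_sub_cancel, sub_add_sub_cancel] at h6
    linarith
  have htop : K = ⊤ := by
    rw [← hK, eq_top_iff, ← span_fourier_closure_eq_top]
    refine Submodule.topologicalClosure_mono (Submodule.span_le.2 ?_)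
    rintro _ ⟨m, rfl⟩
    change Tendsto _ _ _
    -- For fixed `m` the lag `2^{-j} m` tends to `0`, and the autocorrelation of `ψ` is continuous
    -- with value `1` there.
    have h1 : Tendsto (fun j : ℕ => -((2 : ℝ) ^ (-(j : ℤ)) * m)) atTop (𝓝 0) := by
      have : Tendsto (fun j : ℕ => (2 : ℝ)⁻¹ ^ j) atTop (𝓝 0) :=
        tendsto_pow_atTop_nhds_zero_of_lt_one (by norm_num) (by norm_num)
      simpa using (this.mul_const (m : ℝ)).neg
    have h2 := ((continuous_integral_mul_comp_add hW.mra.memLp_psi).tendsto 0).comp h1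
    have h3 := ((Complex.continuous_ofReal.tendsto _).comp h2).const_mul (2 * Real.pi : ℂ)
    have e0 : ∫ t, ψ t * ψ (t + 0) = 1 := by
      rw [← hW.integral_sq]
      simp [sq]
    simp only [e0, Complex.ofReal_one, mul_one] at h3
    rw [fourier_eval_zero, mul_one]
    refine h3.congr' ?_
    filter_upwards [eventually_ge_atTop 1] with j hj
    simp only [Function.comp_apply]
    rw [← integral_norm_sq_filterTransform_mul_cexp hW hj]
    congr 1
    ext x
    rw [fourier_coe_apply]
    congr 2
    push_cast
    have := Real.pi_pos.ne'
    field_simp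
  let G : C(AddCircle (2 * Real.pi), ℂ) := ⟨hp.lift, hF.quotient_liftOn' _⟩
  have hG : G ∈ K := htop ▸ Submodule.mem_top
  exact hG

end CoarseScaleLimit

end TFBM
end

/-! ### The main theorem. -/

theorem mainTheorem3 {Ω : Type*} [MeasurableSpace Ω] (P : Measure Ω) [IsProbabilityMeasure P]
    (H lam σ : ℝ) (hH : 0 < H) (hlam : 0 < lam) (hσ : 0 < σ)
    (M : Set ℝ → Ω → ℝ) (hM : TFBM.IsGaussianRandomMeasure P σ M)
    (B : ℝ → Ω → ℝ) (hB : TFBM.IsTemperedFBM P H lam M B)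
    (φ ψ : ℝ → ℝ) (N : ℕ) (hW : TFBM.IsAdmissibleWavelet φ ψ N) :
    -- the coefficients are centered and square integrable
    (∀ j : ℕ, 1 ≤ j → ∀ k : ℤ, MemLp (TFBM.waveletCoeff φ ψ B j k) 2 P ∧
      ∫ ω, TFBM.waveletCoeff φ ψ B j k ω ∂P = 0) ∧
    -- the periodized spectral density is a convergent series
    (∀ x : ℝ, Summable fun l : ℤ =>
      1 / |lam ^ 2 + (x + 2 * Real.pi * l) ^ 2| ^ (H + 1 / 2)) ∧
    -- the cross-covariance of the coefficients
    (∀ j j' : ℕ, 1 ≤ j → 1 ≤ j' → ∀ k k' : ℤ,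
      IntervalIntegrable (fun x : ℝ =>
        Complex.exp (-(Complex.I * x * ((2 : ℂ) ^ j * k - (2 : ℂ) ^ j' * k'))) *
          ∑' l : ℤ, TFBM.filterTransform φ ψ j x *
            (starRingEnd ℂ) (TFBM.filterTransform φ ψ j' x) /
              ((|lam ^ 2 + (x + 2 * Real.pi * l) ^ 2| ^ (H + 1 / 2) : ℝ) : ℂ))
        volume (-Real.pi) Real.pi ∧
      ((∫ ω, TFBM.waveletCoeff φ ψ B j k ω * TFBM.waveletCoeff φ ψ B j' k' ω ∂P : ℝ) : ℂ) =
        ((σ ^ 2 * Real.Gamma (H + 1 / 2) ^ 2 / (2 * Real.pi) : ℝ) : ℂ) *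
          ∫ x in (-Real.pi)..Real.pi,
            Complex.exp (-(Complex.I * x * ((2 : ℂ) ^ j * k - (2 : ℂ) ^ j' * k'))) *
              ∑' l : ℤ, TFBM.filterTransform φ ψ j x *
                (starRingEnd ℂ) (TFBM.filterTransform φ ψ j' x) /
                  ((|lam ^ 2 + (x + 2 * Real.pi * l) ^ 2| ^ (H + 1 / 2) : ℝ) : ℂ)) ∧
    -- the wavelet spectrum
    (∀ j : ℕ, 1 ≤ j → ∀ k : ℤ,
      IntervalIntegrable (fun x : ℝ =>
        ∑' l : ℤ, ‖TFBM.filterTransform φ ψ j x‖ ^ 2 /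
          |lam ^ 2 + (x + 2 * Real.pi * l) ^ 2| ^ (H + 1 / 2))
        volume (-Real.pi) Real.pi ∧
      ∫ ω, TFBM.waveletCoeff φ ψ B j k ω ^ 2 ∂P =
        σ ^ 2 * Real.Gamma (H + 1 / 2) ^ 2 / (2 * Real.pi) *
          ∫ x in (-Real.pi)..Real.pi,
            ∑' l : ℤ, ‖TFBM.filterTransform φ ψ j x‖ ^ 2 /
              |lam ^ 2 + (x + 2 * Real.pi * l) ^ 2| ^ (H + 1 / 2)) ∧
    -- its limit at coarse scales
    (∀ k : ℤ, Tendsto (fun j : ℕ => ∫ ω, TFBM.waveletCoeff φ ψ B j k ω ^ 2 ∂P) atTop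
      (𝓝 (∑' l : ℤ, σ ^ 2 * Real.Gamma (H + 1 / 2) ^ 2 /
        |lam ^ 2 + (2 * Real.pi * l) ^ 2| ^ (H + 1 / 2)))) := by
  have hs : 1 / 2 < H + 1 / 2 := by linarith
  have hD := TFBM.continuous_periodizedDensity (s := H + 1 / 2) hlam hs
  have hDc : Continuous fun x : ℝ => (TFBM.periodizedDensity lam (H + 1 / 2) x : ℂ) :=
    Complex.continuous_ofReal.comp hD
  have hT := TFBM.continuous_filterTransform hW
  have hsq (j : ℕ) (hj : 1 ≤ j) (k : ℤ) : ∫ ω, TFBM.waveletCoeff φ ψ B j k ω ^ 2 ∂P =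
      σ ^ 2 * Real.Gamma (H + 1 / 2) ^ 2 / (2 * Real.pi) * ∫ x in (-Real.pi)..Real.pi,
        ‖TFBM.filterTransform φ ψ j x‖ ^ 2 * TFBM.periodizedDensity lam (H + 1 / 2) x := by
    have h := TFBM.integral_waveletCoeff_mul_eq hH hlam hM hB hW hj hj k k
    simp only [sub_self, mul_zero, neg_zero, Complex.exp_zero, one_mul, Complex.mul_conj,
      Complex.normSq_eq_norm_sq, ← Complex.ofReal_mul, intervalIntegral.integral_ofReal,
      Complex.ofReal_inj, ← sq] at h
    exact h
  refine ⟨fun j hj k => ⟨TFBM.memLp_waveletCoeff hB hW hj k,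
    TFBM.integral_waveletCoeff hM hB hW hj k⟩, TFBM.summable_spectralDensity hlam hs,
    fun j j' hj hj' k k' => ?_, fun j hj k => ?_, fun k => ?_⟩
  · simp_rw [TFBM.tsum_div_spectralDensity]
    have := hT j
    have := hT j'
    exact ⟨Continuous.intervalIntegrable (by fun_prop) _ _,
      TFBM.integral_waveletCoeff_mul_eq hH hlam hM hB hW hj hj' k k'⟩
  · simp_rw [TFBM.tsum_div_spectralDensity_real]
    have := hT j
    exact ⟨Continuous.intervalIntegrable (by fun_prop) _ _, hsq j hj k⟩
  -- The periodized density is a continuous function on the circle; its value at `0` is the limiting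
  -- series, and the factor `2π` cancels.
  · have h := TFBM.tendsto_integral_norm_sq_filterTransform_mul hW hDc
      (fun x => by rw [TFBM.periodic_periodizedDensity lam (H + 1 / 2) x])
    simp only [← Complex.ofReal_mul, intervalIntegral.integral_ofReal] at h
    have h2 := ((Complex.continuous_re.tendsto _).comp h).const_mul
      (σ ^ 2 * Real.Gamma (H + 1 / 2) ^ 2 / (2 * Real.pi))
    have e : ∑' l : ℤ, σ ^ 2 * Real.Gamma (H + 1 / 2) ^ 2 /
        |lam ^ 2 + (2 * Real.pi * l) ^ 2| ^ (H + 1 / 2) =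
        σ ^ 2 * Real.Gamma (H + 1 / 2) ^ 2 / (2 * Real.pi) *
          (2 * Real.pi * (TFBM.periodizedDensity lam (H + 1 / 2) 0 : ℂ)).re := by
      have h3 := TFBM.tsum_div_spectralDensity_real lam (H + 1 / 2) 0
        (σ ^ 2 * Real.Gamma (H + 1 / 2) ^ 2)
      simp only [zero_add] at h3
      rw [h3, show (2 * Real.pi * (TFBM.periodizedDensity lam (H + 1 / 2) 0 : ℂ)) =
        ((2 * Real.pi * TFBM.periodizedDensity lam (H + 1 / 2) 0 : ℝ) : ℂ) by push_cast; rfl,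
        Complex.ofReal_re]
      have := Real.pi_pos.ne'
      field_simp
    rw [e]
    refine h2.congr' ?_
    filter_upwards [eventually_ge_atTop 1] with j hj
    rw [hsq j hj k]
    rfl
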